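/- Say that $f:\{0,1\}^n\to\{0,1\}$ is a $k$-junta if there is a set of at most $k$ coordinates such that $f(x)$ depends only on the values of $x$ on these coordinates, and that $f$ is $\epsilon$-far from $k$-juntas if it disagrees with every $k$-junta on at least $\epsilon 2^n$ inputs. A non-adaptive algorithm is a randomized algorithm that chooses all its query strings in $\{0,1\}^n$ before it receives the value of $f$ on any of them; it is an $\epsilon$-tester for $k$-juntas if it accepts every $k$-junta with probability at least $5/6$ and rejects every function that is $\epsilon$-far from $k$-juntas with probability at least $5/6$. Theorem. Fix a constant $\alpha\in(1/2,1)$. Let $k:\mathbb{N}\to\mathbb{N}$ and $\epsilon:\mathbb{N}\to\mathbb{R}_{>0}$ satisfy $k(n)\le\alpha n$ and $2^{-n}\le\epsilon(n)\le 1/6$ for all sufficiently large $n$. Then every non-adaptive $\epsilon(n)$-tester for $k(n)$-juntas on functions $f:\{0,1\}^n\to\{0,1\}$ must make $\widetilde\Omega(k^{3/2}/\epsilon)$ queries. That is, there are constants $c>0$ and $C\in\mathbb{N}$, depending only on $\alpha$, such that for all such $k,\epsilon$ and all sufficiently large $n$, every such tester that never makes more than $q$ queries satisfies $$q\ \ge\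 c\cdot\frac{F}{\log^{C}(2+F)},\qquad F=\frac{k(n)^{3/2}}{\epsilon(n)}.$$ -/

import Mathlib

/-- The Boolean cube `{0,1}^n`. -/
abbrev Cube (n : ℕ) : Type := Fin n → Bool

/-- `f : {0,1}^n → {0,1}` is a `k`-junta: its value is determined by the coordinates in some set of
at most `k` indices. -/
def IsJunta {n : ℕ} (k : ℕ) (f : Cube n → Bool) : Prop :=
  ∃ S : Finset (Fin n), S.card ≤ k ∧ DependsOn f (S : Set (Fin n))

/-- `f` is `ε`-far from every `k`-junta: it disagrees with each of them on at least `ε * 2 ^ n`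
inputs. -/
def FarFromJuntas {n : ℕ} (k : ℕ) (ε : ℝ) (f : Cube n → Bool) : Prop :=
  ∀ g : Cube n → Bool, IsJunta k g → ε * 2 ^ n ≤ (hammingDist f g : ℝ)

/-- A deterministic non-adaptive query algorithm for functions `{0,1}^n → {0,1}`: all the query
strings are fixed in advance, and the verdict is a function of the answers to them. -/
structure DetNonadaptive (n : ℕ) : Type where
  /-- the number of queries -/
  numQueries : ℕ
  /-- the query strings -/
  query : Fin numQueries → Cube n
  /-- the verdict (`true` means accept) as a function of the answers -/
  verdict : (Fin numQueries → Bool) → Bool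

/-- The verdict of a deterministic non-adaptive algorithm on the black box `f`. -/
def DetNonadaptive.run {n : ℕ} (D : DetNonadaptive n) (f : Cube n → Bool) : Bool :=
  D.verdict (fun i => f (D.query i))

/-- A randomized non-adaptive algorithm: a probability distribution over deterministic ones (the
random choices are all made before any answer is seen; `DetNonadaptive n` is countable, so a
probability mass function describes an arbitrary distribution). -/
abbrev NonadaptiveAlg (n : ℕ) : Type := PMF (DetNonadaptive n)

/-- The probability that the algorithm `A` accepts the black box `f`. -/
noncomputable def acceptProb {n : ℕ} (A : NonadaptiveAlg n) (f : Cube n → Bool) : ℝ :=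
  ((A.map (fun D => D.run f)) true).toReal

/-- The probability that the algorithm `A` rejects the black box `f`. -/
noncomputable def rejectProb {n : ℕ} (A : NonadaptiveAlg n) (f : Cube n → Bool) : ℝ :=
  ((A.map (fun D => D.run f)) false).toReal

/-- `A` never makes more than `q` queries. -/
def QueriesAtMost {n : ℕ} (A : NonadaptiveAlg n) (q : ℕ) : Prop :=
  ∀ D ∈ A.support, D.numQueries ≤ q

/-- `A` is a (two-sided error) `ε`-tester for `k`-juntas on `{0,1}^n`. -/
def IsJuntaTester {n : ℕ} (k : ℕ) (ε : ℝ) (A : NonadaptiveAlg n) : Prop :=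
  (∀ f : Cube n → Bool, IsJunta k f → 5 / 6 ≤ acceptProb A f) ∧
  (∀ f : Cube n → Bool, FarFromJuntas k ε f → 5 / 6 ≤ rejectProb A f)

/-- The function `x / (log x) ^ C`, up to a shift by `2` inside the logarithm that keeps the
denominator positive. -/
noncomputable def overPolylog (C : ℕ) (x : ℝ) : ℝ := x / Real.log (2 + x) ^ C

/-! The hard functions live on an s × s grid of cells with s = 2 ^ j and s² of order k. Each cell
owns two coordinates; a hidden uniform σ makes one an address bit and the other a content bit. All
address bits and auxiliary coordinates are relevant, while a content bit is relevant only if its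
cell lies in a random set A of density 1/2 - 3/s or 1/2 + 3/s. Since |A| has standard deviation at
most s/2, the number of relevant coordinates is usually at most k in the first case and at least k +
s in the second. The value at a point is a random bit b(address), plus the contents of one selected
cell per row (counted only inside A), plus a mask.

Distance (`card_slot_le_six_mul_hammingDist`): with k + s relevant coordinates, a k-junta ignores an
auxiliary coordinate or an address bit, to which the function is very sensitive, or it ignores the
contents of at least s cells of A. In the latter case a random choice of one cell per row hits an
ignored cell with probability at least 1/3, and there the function is sensitive to an ignored
coordinate.

Indistinguishability (`sum_hardFun_accept_sub_le`): the random b hides everything except differences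
between queries with equal addresses. Two queries that differ on many cells rarely share an address,
because σ is random. So colliding queries differ on at most d = O(log q) cells, and a random shift ρ
selects each of these with probability only 1/s. About dq/s cells of A are therefore exposed,
whereas telling the two densities apart takes of order s² cells (chi-square bound). Hence q must be
of order s³/d, that is k^(3/2) up to a logarithm.

The factor 1/ε comes from planting the function in a random subcube of density 2 ^ (-t), of order ε:
only a fraction 2 ^ (-t) of the queries falls into it on average. When k is at most logarithmic in
k^(3/2)/ε, the elementary bound of order 1/ε from a random odd-parity slice suffices. -/

/-- Negate the `i`-th coordinate of `x`. -/
def flipAt {ι : Type*} [DecidableEq ι] (x : ι → Bool) (i : ι) : ι → Bool :=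
  Function.update x i (!x i)

/-! ### Coordinate flips and counting on the cube -/

section Flip

variable {ι : Type*} [DecidableEq ι]

theorem flipAt_self (x : ι → Bool) (i : ι) : flipAt x i i = !x i := by simp [flipAt]

theorem flipAt_of_ne (x : ι → Bool) {i j : ι} (h : j ≠ i) : flipAt x i j = x j := by
  simp [flipAt, h]

theorem flipAt_flipAt (x : ι → Bool) (i : ι) : flipAt (flipAt x i) i = x := by
  ext j
  by_cases h : j = i
  · subst h; simp [flipAt_self]
  · simp [flipAt_of_ne _ h]

theorem flipAt_comm (x : ι → Bool) (i j : ι) :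
    flipAt (flipAt x i) j = flipAt (flipAt x j) i := by
  ext l
  by_cases hi : l = i <;> by_cases hj : l = j
  · subst hi; subst hj; rfl
  · subst hi; simp [flipAt_self, flipAt_of_ne _ hj]
  · subst hj; simp [flipAt_self, flipAt_of_ne _ hi]
  · simp [flipAt_of_ne _ hi, flipAt_of_ne _ hj]

theorem flipAt_comp {κ : Type*} [DecidableEq κ] (e : κ ↪ ι) (x : ι → Bool) (i : κ) :
    flipAt x (e i) ∘ e = flipAt (x ∘ e) i := by
  ext l
  by_cases h : l = i
  · subst h; simp [flipAt_self]
  · have : e l ≠ e i := fun h' => h (e.injective h')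
    simp [flipAt_of_ne _ h, flipAt_of_ne _ this]

end Flip

/-- If `g` ignores the coordinate `e x` that is negated at `x`, then `f` disagrees with `g` on at
least half of the points at which this negation changes the value of `f`. -/
theorem card_sensitive_le_two_mul_hammingDist {n : ℕ} (f g : Cube n → Bool) (J : Set (Fin n))
    (hg : DependsOn g J) (e : Cube n → Fin n) (he : ∀ x, e x ∉ J)
    (hee : ∀ x, e (flipAt x (e x)) = e x) :
    (Finset.univ.filter fun x => f x ≠ f (flipAt x (e x))).card ≤ 2 * hammingDist f g := by
  classical
  set τ : Cube n → Cube n := fun x => flipAt x (e x) with hτ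
  -- The choice of coordinate is unchanged by the flip (`hee`), so the points pair up. As g agrees
  -- on each pair, f errs on at least one point of a sensitive pair.
  have hinv : Function.Involutive τ := fun x => by
    simp only [hτ, hee, flipAt_flipAt]
  have hgτ : ∀ x, g (τ x) = g x := fun x => hg fun i hi =>
    flipAt_of_ne _ fun h => he x (h ▸ hi)
  have hsub : (Finset.univ.filter fun x => f x ≠ f (τ x)) ⊆
      (Finset.univ.filter fun x => f x ≠ g x) ∪
        (Finset.univ.filter fun x => f x ≠ g x).image τ := by
    intro x hx
    simp only [Finset.mem_filter, Finset.mem_univ, true_and, Finset.mem_union,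
      Finset.mem_image] at hx ⊢
    by_cases h : f x = g x
    · refine Or.inr ⟨τ x, ?_, hinv x⟩
      rw [hgτ, ← h]
      exact fun h' => hx h'.symm
    · exact Or.inl h
  have h1 := (Finset.card_le_card hsub).trans (Finset.card_union_le _ _)
  have h2 : ((Finset.univ.filter fun x => f x ≠ g x).image τ).card ≤ _ := Finset.card_image_le
  have h3 : hammingDist f g = (Finset.univ.filter fun x => f x ≠ g x).card := rfl
  rw [← h3] at h1 h2
  refine h1.trans ?_
  omega

/-- If negating the coordinate `i` preserves `Q` and toggles `P` on `Q`, then `P` holds on half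
of `Q`. -/
theorem card_le_two_mul_card_and_of_toggle {n : ℕ} (Q P : Cube n → Prop) [DecidablePred Q]
    [DecidablePred P] (i : Fin n) (hQ : ∀ x, Q x → Q (flipAt x i))
    (hP : ∀ x, Q x → ¬ P x → P (flipAt x i)) :
    (Finset.univ.filter Q).card ≤ 2 * (Finset.univ.filter fun x => Q x ∧ P x).card := by
  classical
  have hsub : Finset.univ.filter Q ⊆ (Finset.univ.filter fun x => Q x ∧ P x) ∪
      (Finset.univ.filter fun x => Q x ∧ P x).image fun x => flipAt x i := by
    intro x hx
    simp only [Finset.mem_filter, Finset.mem_univ, true_and, Finset.mem_union,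
      Finset.mem_image] at hx ⊢
    by_cases h : P x
    · exact Or.inl ⟨hx, h⟩
    · exact Or.inr ⟨flipAt x i, ⟨hQ x hx, hP x hx h⟩, flipAt_flipAt x i⟩
  have h1 := (Finset.card_le_card hsub).trans (Finset.card_union_le _ _)
  have h2 : ((Finset.univ.filter fun x => Q x ∧ P x).image fun x => flipAt x i).card ≤ _ :=
    Finset.card_image_le
  omega

/-- Each pattern on a set of coordinates has the same number of extensions to the cube. -/
theorem card_filter_comp_eq_mul {ι T : Type*} [Fintype ι] [DecidableEq ι] [Fintype T]
    [DecidableEq T] (φ : T ↪ ι) (v : T → Bool) :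
    (Finset.univ.filter fun x : ι → Bool => x ∘ φ = v).card * 2 ^ Fintype.card T =
      2 ^ Fintype.card ι := by
  classical
  have key : ∀ w : T → Bool, (Finset.univ.filter fun x : ι → Bool => x ∘ φ = w).card =
      (Finset.univ.filter fun x : ι → Bool => x ∘ φ = v).card := by
    intro w
    -- Translation by d, supported on the range of φ, exchanges the fibres over v and w.
    let d : ι → Bool := fun i => if h : ∃ t, φ t = i then xor (v h.choose) (w h.choose) else false
    have hd : ∀ t, d (φ t) = xor (v t) (w t) := fun t => by
      have h : ∃ t', φ t' = φ t := ⟨t, rfl⟩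
      have h' : h.choose = t := φ.injective h.choose_spec
      simp only [d, dif_pos h, h']
    have hxx : ∀ x : ι → Bool, (fun i => xor (xor (x i) (d i)) (d i)) = x := fun x => by
      ext i; simp
    refine Finset.card_bij' (fun x _ i => xor (x i) (d i)) (fun x _ i => xor (x i) (d i))
      ?_ ?_ (fun x _ => hxx x) (fun x _ => hxx x)
    · intro x hx
      simp only [Finset.mem_filter, Finset.mem_univ, true_and] at hx ⊢
      ext t
      have := congrFun hx t
      simp only [Function.comp_apply] at this ⊢
      rw [hd, this]
      cases v t <;> cases w t <;> rfl
    · intro x hx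
      simp only [Finset.mem_filter, Finset.mem_univ, true_and] at hx ⊢
      ext t
      have := congrFun hx t
      simp only [Function.comp_apply] at this ⊢
      rw [hd, this]
      cases v t <;> cases w t <;> rfl
  have h := Finset.card_eq_sum_card_fiberwise (s := (Finset.univ : Finset (ι → Bool)))
    (t := (Finset.univ : Finset (T → Bool))) (f := fun x => x ∘ φ) (fun _ _ => by simp)
  rw [Finset.sum_congr rfl fun w _ => key w] at h
  simp only [Finset.sum_const, Finset.card_univ, Fintype.card_fun, Fintype.card_bool,
    smul_eq_mul] at h
  rw [h, mul_comm]

/-! ### Biased product measures: chi-square and Chebyshev bounds -/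

section Bias

/-- The Bernoulli weights of mean `1 / 2 + δ`. -/
noncomputable def bias (δ : ℝ) (b : Bool) : ℝ := if b then 1 / 2 + δ else 1 / 2 - δ

/-- The product of Bernoulli weights of mean `1 / 2 + δ`. -/
noncomputable def biasProd {P : Type*} [Fintype P] (δ : ℝ) (A : P → Bool) : ℝ :=
  ∏ p, bias δ (A p)

variable {P : Type*} [Fintype P]

theorem biasProd_nonneg {δ : ℝ} (h : |δ| ≤ 1 / 2) (A : P → Bool) : 0 ≤ biasProd δ A := by
  rw [abs_le] at h
  refine Finset.prod_nonneg fun p _ => ?_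
  unfold bias
  split_ifs <;> linarith

theorem biasProd_zero (A : P → Bool) : biasProd 0 A = (1 / 2) ^ Fintype.card P := by
  simp [biasProd, bias]

variable [DecidableEq P]

theorem sum_prod_bool (g : P → Bool → ℝ) :
    ∑ A : P → Bool, ∏ p, g p (A p) = ∏ p, (g p true + g p false) := by
  have h := Finset.prod_univ_sum (fun _ : P => (Finset.univ : Finset Bool)) g
  rw [Fintype.piFinset_univ] at h
  simpa only [Fintype.sum_bool] using h.symm

theorem sum_biasProd (δ : ℝ) : ∑ A : P → Bool, biasProd δ A = 1 := by
  simp only [biasProd, sum_prod_bool fun _ => bias δ]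
  simp [bias]
  norm_num

/-- The chi-square bound on the distance of a biased product from the uniform distribution. -/
theorem abs_sum_biasProd_sub_le (δ : ℝ) (ψ : (P → Bool) → ℝ) (hψ : ∀ A, |ψ A| ≤ 1) :
    |∑ A, biasProd δ A * ψ A - ∑ A, biasProd 0 A * ψ A| ≤
      √((1 + 4 * δ ^ 2) ^ Fintype.card P - 1) := by
  set r := Fintype.card P
  have h1 : |∑ A, biasProd δ A * ψ A - ∑ A, biasProd 0 A * ψ A| ≤
      ∑ A : P → Bool, |biasProd δ A - biasProd 0 A| := by
    rw [← Finset.sum_sub_distrib]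
    refine (Finset.abs_sum_le_sum_abs _ _).trans (Finset.sum_le_sum fun A _ => ?_)
    rw [← sub_mul, abs_mul]
    exact mul_le_of_le_one_right (abs_nonneg _) (hψ A)
  refine h1.trans (Real.le_sqrt_of_sq_le ?_)
  -- Cauchy–Schwarz over the 2 ^ r points turns the L¹ distance into the chi-square distance, which
  -- is multiplicative over coordinates.
  have h2 := sq_sum_le_card_mul_sum_sq (s := (Finset.univ : Finset (P → Bool)))
    (f := fun A => |biasProd δ A - biasProd 0 A|)
  refine h2.trans (le_of_eq ?_)
  have h3 : ∑ A : P → Bool, biasProd δ A ^ 2 = ((1 + 4 * δ ^ 2) / 2) ^ r := by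
    simp only [biasProd, ← Finset.prod_pow]
    rw [sum_prod_bool fun _ b => bias δ b ^ 2]
    simp only [bias, Finset.prod_const, Finset.card_univ, if_true]
    congr 1
    simp only [Bool.false_eq_true, if_false]
    ring
  have h4 : ∑ A : P → Bool, |biasProd δ A - biasProd 0 A| ^ 2 =
      ((1 + 4 * δ ^ 2) / 2) ^ r - (1 / 2) ^ r := by
    simp only [sq_abs, sub_sq, biasProd_zero, Finset.sum_add_distrib, Finset.sum_sub_distrib, h3]
    rw [← Finset.sum_mul, ← Finset.mul_sum, sum_biasProd]
    simp only [Finset.sum_const, Finset.card_univ, Fintype.card_fun, Fintype.card_bool,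
      nsmul_eq_mul]
    have : ((2 : ℝ)) ^ r * (1 / 2) ^ r = 1 := by rw [← mul_pow]; norm_num
    push_cast
    linear_combination (1 / 2 : ℝ) ^ r * this
  rw [h4]
  simp only [Finset.card_univ, Fintype.card_fun, Fintype.card_bool]
  push_cast
  have : ((2 : ℝ)) ^ r * (1 / 2) ^ r = 1 := by rw [← mul_pow]; norm_num
  rw [mul_sub, this, ← mul_pow, mul_div_cancel₀ _ (two_ne_zero' ℝ)]

/-- Summing out the coordinates that a function ignores. -/
theorem exists_sum_biasProd_mul_eq (φ : (P → Bool) → ℝ) (R : Finset P)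
    (hφ : DependsOn φ (R : Set P)) (hb : ∀ A, |φ A| ≤ 1) :
    ∃ ψ : ({p // p ∈ R} → Bool) → ℝ, (∀ A, |ψ A| ≤ 1) ∧
      ∀ δ, ∑ A, biasProd δ A * φ A = ∑ A, biasProd δ A * ψ A := by
  classical
  let E := Equiv.piEquivPiSubtypeProd (fun p => p ∈ R) (fun _ : P => Bool)
  refine ⟨fun B => φ (E.symm (B, fun _ => false)), fun _ => hb _, fun δ => ?_⟩
  rw [← Equiv.sum_comp E.symm, Fintype.sum_prod_type]
  refine Finset.sum_congr rfl fun B _ => ?_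
  have h1 : ∀ C, φ (E.symm (B, C)) = φ (E.symm (B, fun _ => false)) := fun C =>
    hφ fun p hp => by
      have : p ∈ R := hp
      simp [E, Equiv.piEquivPiSubtypeProd, this]
  have h2 : ∀ C, biasProd δ (E.symm (B, C)) = biasProd δ B * biasProd δ C := fun C => by
    unfold biasProd
    rw [← Fintype.prod_subtype_mul_prod_subtype (fun p => p ∈ R)]
    congr 1
    · refine Finset.prod_congr (by ext; simp) fun p _ => ?_
      simp [E, Equiv.piEquivPiSubtypeProd, p.2]
    · refine Finset.prod_congr (by ext; simp) fun p _ => ?_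
      simp [E, Equiv.piEquivPiSubtypeProd, p.2]
  simp only [h1, h2]
  rw [← Finset.sum_mul, ← Finset.mul_sum, sum_biasProd, mul_one]

/-- Both biases are compared with the uniform measure. The marginal ψ on R is the same function for
every δ, so only |R| enters the bound. -/
theorem abs_sum_biasProd_sub_neg_le (δ : ℝ) (φ : (P → Bool) → ℝ) (R : Finset P)
    (hφ : DependsOn φ (R : Set P)) (hb : ∀ A, |φ A| ≤ 1) :
    |∑ A, biasProd (-δ) A * φ A - ∑ A, biasProd δ A * φ A| ≤
      2 * √((1 + 4 * δ ^ 2) ^ R.card - 1) := by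
  obtain ⟨ψ, hψ, hs⟩ := exists_sum_biasProd_mul_eq φ R hφ hb
  rw [hs, hs]
  have h1 := abs_sum_biasProd_sub_le δ ψ hψ
  have h2 := abs_sum_biasProd_sub_le (-δ) ψ hψ
  rw [neg_sq] at h2
  rw [Fintype.card_coe] at h1 h2
  rw [abs_le] at *
  constructor <;> linarith [h1.1, h1.2, h2.1, h2.2]

theorem sum_biasProd_mul_sq_le (δ : ℝ) :
    ∑ A : P → Bool, biasProd δ A *
      (((Finset.univ.filter fun p => A p).card : ℝ) - (1 / 2 + δ) * Fintype.card P) ^ 2 ≤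
        (Fintype.card P : ℝ) / 4 := by
  classical
  let Y : Bool → ℝ := fun b => (if b then 1 else 0) - (1 / 2 + δ)
  have hY : ∀ A : P → Bool, ((Finset.univ.filter fun p => A p).card : ℝ) -
      (1 / 2 + δ) * Fintype.card P = ∑ p, Y (A p) := fun A => by
    simp only [Y, Finset.sum_sub_distrib, Finset.sum_boole, Finset.sum_const, Finset.card_univ,
      nsmul_eq_mul]
    ring
  -- Centred coordinates are independent: off-diagonal covariances vanish and each variance is 1/4 -
  -- δ².
  have hpq : ∀ p q : P, ∑ A : P → Bool, biasProd δ A * (Y (A p) * Y (A q)) =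
      if p = q then 1 / 4 - δ ^ 2 else 0 := by
    intro p q
    have h1 : ∀ A : P → Bool, biasProd δ A * (Y (A p) * Y (A q)) =
        ∏ i, bias δ (A i) * ((if i = p then Y (A i) else 1) * (if i = q then Y (A i) else 1)) := by
      intro A
      simp only [Finset.prod_mul_distrib, Finset.prod_ite_eq', Finset.mem_univ, if_true, biasProd]
    simp only [h1]
    rw [sum_prod_bool fun i b =>
      bias δ b * ((if i = p then Y b else 1) * (if i = q then Y b else 1))]
    split_ifs with h
    · subst h
      rw [Finset.prod_eq_single p]
      · simp [bias, Y]; ring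
      · intro i _ hi
        simp [hi, bias]; norm_num
      · simp
    · refine Finset.prod_eq_zero (Finset.mem_univ p) ?_
      simp [h, bias, Y]; ring
  have hexp : ∑ A : P → Bool, biasProd δ A * (∑ p, Y (A p)) ^ 2 =
      ∑ p, ∑ q, ∑ A : P → Bool, biasProd δ A * (Y (A p) * Y (A q)) := by
    simp only [pow_two, Finset.sum_mul_sum]
    simp only [Finset.mul_sum]
    rw [Finset.sum_comm]
    exact Finset.sum_congr rfl fun p _ => Finset.sum_comm
  simp only [hY, hexp, hpq]
  simp only [Finset.sum_ite_eq, Finset.mem_univ, if_true, Finset.sum_const, Finset.card_univ,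
    nsmul_eq_mul]
  have : (0 : ℝ) ≤ Fintype.card P := by positivity
  nlinarith [mul_nonneg this (sq_nonneg δ)]

/-- Chebyshev's inequality for the number of successes in independent Bernoulli trials. -/
theorem sum_biasProd_deviation_le {δ : ℝ} (hδ : |δ| ≤ 1 / 2) {T : ℝ} (hT : 0 < T)
    (B : (P → Bool) → Prop) [DecidablePred B]
    (hB : ∀ A, B A → T ≤ |((Finset.univ.filter fun p => A p).card : ℝ) -
      (1 / 2 + δ) * Fintype.card P|) :
    ∑ A : P → Bool, biasProd δ A * (if B A then 1 else 0) ≤ Fintype.card P / (4 * T ^ 2) := by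
  have h := sum_biasProd_mul_sq_le (P := P) δ
  have h1 : (∑ A : P → Bool, biasProd δ A * (if B A then 1 else 0)) * T ^ 2 ≤
      Fintype.card P / 4 := by
    refine le_trans ?_ h
    rw [Finset.sum_mul]
    refine Finset.sum_le_sum fun A _ => ?_
    rw [mul_assoc]
    refine mul_le_mul_of_nonneg_left ?_ (biasProd_nonneg hδ A)
    split_ifs with hA
    · rw [one_mul, ← sq_abs (_ - _ : ℝ)]
      exact pow_le_pow_left₀ hT.le (hB A hA) 2
    · rw [zero_mul]; positivity
  rw [le_div_iff₀ (by positivity)]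
  linarith

end Bias

/-! ### Acceptance probabilities and Yao's principle -/

section Tester

theorem acceptProb_eq_tsum {n : ℕ} (A : NonadaptiveAlg n) (f : Cube n → Bool) :
    acceptProb A f = ∑' D, (A D).toReal * (if D.run f then 1 else 0) := by
  unfold acceptProb
  rw [PMF.map_apply, ENNReal.tsum_toReal_eq]
  · refine tsum_congr fun D => ?_
    cases h : D.run f <;> simp
  · intro D
    split_ifs
    · exact PMF.apply_ne_top _ _
    · simp

theorem acceptProb_nonneg {n : ℕ} (A : NonadaptiveAlg n) (f : Cube n → Bool) :
    0 ≤ acceptProb A f := ENNReal.toReal_nonneg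

theorem acceptProb_add_rejectProb {n : ℕ} (A : NonadaptiveAlg n) (f : Cube n → Bool) :
    acceptProb A f + rejectProb A f = 1 := by
  unfold acceptProb rejectProb
  rw [← ENNReal.toReal_add (PMF.apply_ne_top _ _) (PMF.apply_ne_top _ _)]
  have h := (A.map fun D => D.run f).tsum_coe
  rw [tsum_bool, add_comm] at h
  rw [h, ENNReal.toReal_one]

theorem summable_toReal {n : ℕ} (A : NonadaptiveAlg n) : Summable fun D => (A D).toReal :=
  ENNReal.summable_toReal A.tsum_coe_ne_top

theorem tsum_toReal {n : ℕ} (A : NonadaptiveAlg n) : ∑' D, (A D).toReal = 1 := by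
  rw [← ENNReal.tsum_toReal_eq fun D => PMF.apply_ne_top _ _, A.tsum_coe, ENNReal.toReal_one]

/-- Yao's principle: a bound that holds for deterministic algorithms holds for randomized ones. -/
theorem sum_mul_acceptProb_le {n : ℕ} {I : Type*} [Fintype I] (A : NonadaptiveAlg n) (c : I → ℝ)
    (f : I → Cube n → Bool) (B : ℝ)
    (h : ∀ D ∈ A.support, ∑ i, c i * (if D.run (f i) then 1 else 0) ≤ B) :
    ∑ i, c i * acceptProb A (f i) ≤ B := by
  have hs : ∀ i, Summable fun D => c i * ((A D).toReal * (if D.run (f i) then (1 : ℝ) else 0)) :=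
    fun i => Summable.mul_left _ <| Summable.of_nonneg_of_le
      (fun D => by positivity) (fun D => by
        split_ifs <;> simp) (summable_toReal A)
  simp only [acceptProb_eq_tsum, ← tsum_mul_left]
  rw [← Summable.tsum_finsetSum fun i _ => hs i]
  have h2 : ∑' D, (A D).toReal * B = B := by rw [tsum_mul_right, tsum_toReal, one_mul]
  rw [← h2]
  refine Summable.tsum_le_tsum (fun D => ?_) (summable_sum fun i _ => hs i)
    ((summable_toReal A).mul_right B)
  by_cases hD : D ∈ A.support
  · have := mul_le_mul_of_nonneg_left (h D hD) (ENNReal.toReal_nonneg (a := A D))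
    refine le_trans (le_of_eq ?_) this
    rw [Finset.mul_sum]
    exact Finset.sum_congr rfl fun i _ => by ring
  · have : A D = 0 := by simpa [PMF.mem_support_iff] using hD
    simp [this]

end Tester

/-! ### The hard functions -/

section Construction

abbrev Col (j : ℕ) : Type := Fin j → Bool

/-- The cells of a square grid with `2 ^ j` rows and columns. -/
abbrev Cell (j : ℕ) : Type := Col j × Col j

/-- Selector bits for each row, slot bits, parity bits and a switch. -/
abbrev Aux (j t r : ℕ) : Type := (Col j × Fin j) ⊕ Fin t ⊕ Fin (r + 1) ⊕ Unit

/-- The coordinates of the hard functions: a pair of coordinates for each cell and the auxiliary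
coordinates. -/
abbrev Coord (j t r : ℕ) : Type := (Cell j × Bool) ⊕ Aux j t r

instance (j t r : ℕ) : DecidableEq (Aux j t r) := instDecidableEqSum

instance (j t r : ℕ) : DecidableEq (Coord j t r) := instDecidableEqSum

namespace Coord

variable {j t r : ℕ}

abbrev pair (p : Cell j) (b : Bool) : Coord j t r := .inl (p, b)
abbrev sel (i : Col j) (k : Fin j) : Coord j t r := .inr (.inl (i, k))
abbrev slot (i : Fin t) : Coord j t r := .inr (.inr (.inl i))
abbrev par (i : Fin (r + 1)) : Coord j t r := .inr (.inr (.inr (.inl i)))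
abbrev switch : Coord j t r := .inr (.inr (.inr (.inr ())))

end Coord

open Coord

variable {j t r n : ℕ}

abbrev Addr (j : ℕ) : Type := (Cell j → Bool) × (Col j → Col j)

/-- The values of the address bits (the `σ p`-th coordinate of each pair `p`) and of the
selectors. -/
def address (σ : Cell j → Bool) (X : Coord j t r → Bool) : Addr j :=
  (fun p => X (pair p (σ p)), fun i k => X (sel i k))

/-- The values of the coordinates that are not address bits in their pair. -/
def content (σ : Cell j → Bool) (X : Coord j t r → Bool) (p : Cell j) : Bool := X (pair p (!σ p))

/-- The cell that the selectors `c` point to in row `i`, after a shift by `ρ`. -/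
def selected (ρ c : Col j → Col j) (i : Col j) : Cell j := (i, fun k => xor (c i k) (ρ i k))

def bit (b : Bool) : ZMod 2 := if b then 1 else 0

/-- The parity of all bits of an address. -/
def addrParity (a : Addr j) : ZMod 2 := ∑ p, bit (a.1 p) + ∑ u : Col j × Fin j, bit (a.2 u.1 u.2)

/-- The parity of the contents of the selected cells that lie in `A`. -/
def cellSum (σ : Cell j → Bool) (ρ : Col j → Col j) (A : Cell j → Bool) (X : Coord j t r → Bool) :
    ZMod 2 :=
  ∑ i, bit (A (selected ρ (address σ X).2 i)) * bit (content σ X (selected ρ (address σ X).2 i))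

/-- The parity bits balance the value on every subcube of slots, and their number is free, which
lets the count of coordinates match k exactly. The switch makes every address bit and selector
influential whatever b is. -/
def mask (σ : Cell j → Bool) (X : Coord j t r → Bool) : ZMod 2 :=
  ∑ i, bit (X (par i)) + bit (X switch) * addrParity (address σ X)

def hardVal (σ : Cell j → Bool) (ρ : Col j → Col j) (b : Addr j → ZMod 2) (A : Cell j → Bool)
    (X : Coord j t r → Bool) : ZMod 2 :=
  b (address σ X) + cellSum σ ρ A X + mask σ X

/-- The hard functions: they vanish unless the slot bits have the value `z`. -/
def hardFun (e : Coord j t r ↪ Fin n) (z : Fin t → Bool) (σ : Cell j → Bool) (ρ : Col j → Col j)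
    (b : Addr j → ZMod 2) (A : Cell j → Bool) : Cube n → Bool :=
  fun x => decide ((∀ i, x (e (slot i)) = z i) ∧ hardVal σ ρ b A (x ∘ e) = 1)

end Construction

/-! ### Indistinguishability of the two densities -/

section Indistinguishable

open Coord

variable {j t r n q : ℕ}

/-- The number of choices of `b` for which the verdict on the values at the points `X i`, `i ∈ Act`,
is positive. -/
noncomputable def acceptCount (σ : Cell j → Bool) (ρ : Col j → Col j)
    (X : Fin q → Coord j t r → Bool) (Act : Finset (Fin q)) (v : (Fin q → Bool) → Bool)
    (A : Cell j → Bool) : ℝ :=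
  ∑ b : Addr j → ZMod 2, if v fun i => decide (i ∈ Act ∧ hardVal σ ρ b A (X i) = 1) then 1 else 0

theorem acceptCount_nonneg (σ : Cell j → Bool) (ρ : Col j → Col j)
    (X : Fin q → Coord j t r → Bool) (Act : Finset (Fin q)) (v : (Fin q → Bool) → Bool)
    (A : Cell j → Bool) : 0 ≤ acceptCount σ ρ X Act v A :=
  Finset.sum_nonneg fun _ _ => by split_ifs <;> simp

theorem acceptCount_le (σ : Cell j → Bool) (ρ : Col j → Col j)
    (X : Fin q → Coord j t r → Bool) (Act : Finset (Fin q)) (v : (Fin q → Bool) → Bool)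
    (A : Cell j → Bool) : acceptCount σ ρ X Act v A ≤ Fintype.card (Addr j → ZMod 2) := by
  refine (Finset.sum_le_card_nsmul _ _ 1 fun _ _ => ?_).trans (by simp)
  split_ifs <;> simp

/-- Changing A outside R alters the values at active queries by an amount that depends on the
address alone. A translation of b absorbs this, and the sum over all b is invariant under
translation. -/
theorem dependsOn_acceptCount (σ : Cell j → Bool) (ρ : Col j → Col j)
    (X : Fin q → Coord j t r → Bool) (Act : Finset (Fin q)) (v : (Fin q → Bool) → Bool)
    (R : Finset (Cell j))
    (hR : ∀ i ∈ Act, ∀ i' ∈ Act, address σ (X i) = address σ (X i') → ∀ m,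
      selected ρ (address σ (X i)).2 m ∉ R →
        content σ (X i) (selected ρ (address σ (X i)).2 m) =
          content σ (X i') (selected ρ (address σ (X i)).2 m)) :
    DependsOn (acceptCount σ ρ X Act v) (R : Set (Cell j)) := by
  classical
  intro A A' hA
  have hconst : ∀ i ∈ Act, ∀ i' ∈ Act, address σ (X i) = address σ (X i') →
      cellSum σ ρ A (X i) - cellSum σ ρ A' (X i) =
        cellSum σ ρ A (X i') - cellSum σ ρ A' (X i') := by
    intro i hi i' hi' h
    unfold cellSum
    rw [← h, ← Finset.sum_sub_distrib, ← Finset.sum_sub_distrib]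
    refine Finset.sum_congr rfl fun m _ => ?_
    by_cases hm : selected ρ (address σ (X i)).2 m ∈ R
    · rw [hA _ hm]; ring
    · rw [hR i hi i' hi' h m hm]
  -- By `hconst` any active query with the given address gives the same shift; at addresses that no
  -- active query has, the value is immaterial.
  let D : Addr j → ZMod 2 := fun α =>
    if h : ∃ i ∈ Act, address σ (X i) = α then
      cellSum σ ρ A (X h.choose) - cellSum σ ρ A' (X h.choose) else 0
  have hD : ∀ i ∈ Act, D (address σ (X i)) = cellSum σ ρ A (X i) - cellSum σ ρ A' (X i) := by
    intro i hi
    have h : ∃ i' ∈ Act, address σ (X i') = address σ (X i) := ⟨i, hi, rfl⟩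
    simp only [D, dif_pos h]
    exact hconst _ h.choose_spec.1 i hi h.choose_spec.2
  refine Fintype.sum_equiv (Equiv.addRight D) _ _ fun b => ?_
  have : (fun i => decide (i ∈ Act ∧ hardVal σ ρ b A (X i) = 1)) =
      fun i => decide (i ∈ Act ∧ hardVal σ ρ (Equiv.addRight D b) A' (X i) = 1) := by
    ext i
    refine decide_eq_decide.2 (and_congr_right fun hi => ?_)
    have : hardVal σ ρ (Equiv.addRight D b) A' (X i) = hardVal σ ρ b A (X i) := by
      simp only [hardVal, Equiv.coe_addRight, Pi.add_apply, hD i hi]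
      ring
    rw [this]
  rw [this]

theorem sum_acceptCount_sub_le_card {δ : ℝ} (hδ : |δ| ≤ 1 / 2) (σ : Cell j → Bool)
    (ρ : Col j → Col j)
    (X : Fin q → Coord j t r → Bool) (Act : Finset (Fin q)) (v : (Fin q → Bool) → Bool) :
    ∑ A, biasProd (-δ) A * acceptCount σ ρ X Act v A -
      ∑ A, biasProd δ A * acceptCount σ ρ X Act v A ≤ Fintype.card (Addr j → ZMod 2) := by
  have h1 : ∑ A, biasProd (-δ) A * acceptCount σ ρ X Act v A ≤
      ∑ A : Cell j → Bool, biasProd (-δ) A * Fintype.card (Addr j → ZMod 2) :=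
    Finset.sum_le_sum fun A _ => mul_le_mul_of_nonneg_left (acceptCount_le ..)
      (biasProd_nonneg (by rwa [abs_neg]) A)
  have h2 : 0 ≤ ∑ A, biasProd δ A * acceptCount σ ρ X Act v A :=
    Finset.sum_nonneg fun A _ => mul_nonneg (biasProd_nonneg hδ A) (acceptCount_nonneg ..)
  rw [← Finset.sum_mul, sum_biasProd, one_mul] at h1
  linarith

/-- Few exposed cells: the chi-square bound gives η. Many exposed cells: the trivial bound 1 is
below |R| / r₀. The sum of both terms is linear in |R|, so it can be averaged over ρ. -/
theorem sum_acceptCount_sub_le {δ : ℝ} (hδ : |δ| ≤ 1 / 2) (σ : Cell j → Bool) (ρ : Col j → Col j)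
    (X : Fin q → Coord j t r → Bool) (Act : Finset (Fin q)) (v : (Fin q → Bool) → Bool)
    (R : Finset (Cell j)) (hR : DependsOn (acceptCount σ ρ X Act v) (R : Set (Cell j)))
    {r₀ : ℝ} (hr₀ : 0 < r₀) {η : ℝ} (hη : 0 ≤ η)
    (hηr : ∀ m : ℕ, (m : ℝ) ≤ r₀ → 2 * √((1 + 4 * δ ^ 2) ^ m - 1) ≤ η) :
    ∑ A, biasProd (-δ) A * acceptCount σ ρ X Act v A -
      ∑ A, biasProd δ A * acceptCount σ ρ X Act v A ≤
        Fintype.card (Addr j → ZMod 2) * (η + R.card / r₀) := by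
  set N : ℝ := ((Fintype.card (Addr j → ZMod 2) : ℕ) : ℝ) with hN
  have hN0 : 0 < N := by rw [hN]; exact_mod_cast Fintype.card_pos
  rcases le_or_gt (R.card : ℝ) r₀ with h | h
  · have h1 := abs_sum_biasProd_sub_neg_le δ (fun A => acceptCount σ ρ X Act v A / N) R
      (fun A A' hA => by simp only [hR hA]) (fun A => by
        rw [abs_of_nonneg (div_nonneg (acceptCount_nonneg ..) hN0.le), div_le_one hN0]
        exact acceptCount_le ..)
    have h2 := (le_abs_self _).trans (h1.trans (hηr _ h))
    simp only [mul_div_assoc', ← Finset.sum_div] at h2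
    rw [← sub_div, div_le_iff₀ hN0] at h2
    have : 0 ≤ N * (R.card / r₀) := by positivity
    linarith
  · refine (sum_acceptCount_sub_le_card hδ ..).trans ?_
    rw [← hN]
    have : 1 ≤ R.card / r₀ := (one_le_div hr₀).2 h.le
    nlinarith

/-- Few shifts select a given cell. -/
theorem card_selected_mul (c : Col j → Col j) (p : Cell j) :
    (Finset.univ.filter fun ρ : Col j → Col j => selected ρ c p.1 = p).card * 2 ^ j =
      Fintype.card (Col j → Col j) := by
  classical
  let w : Col j := fun k => xor (c p.1 k) (p.2 k)
  have h1 : (Finset.univ.filter fun ρ : Col j → Col j => selected ρ c p.1 = p) =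
      Fintype.piFinset fun i => if i = p.1 then {w} else Finset.univ := by
    ext ρ
    simp only [Finset.mem_filter, Finset.mem_univ, true_and, Fintype.mem_piFinset, selected,
      Prod.ext_iff]
    constructor
    · intro h i
      split_ifs with hi
      · subst hi
        rw [Finset.mem_singleton]
        ext k
        have := congrFun h k
        simp only [w, ← this]
        cases c p.1 k <;> cases ρ p.1 k <;> rfl
      · exact Finset.mem_univ _
    · intro h
      have := h p.1
      rw [if_pos rfl, Finset.mem_singleton] at this
      ext k
      rw [this]
      simp only [w]
      cases c p.1 k <;> cases p.2 k <;> rfl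
  rw [h1, Fintype.card_piFinset, Fintype.card_pi,
    ← Finset.mul_prod_erase _ _ (Finset.mem_univ p.1),
    ← Finset.mul_prod_erase (Finset.univ) (fun _ => Fintype.card (Col j)) (Finset.mem_univ p.1)]
  rw [if_pos rfl, Finset.card_singleton, one_mul, mul_comm]
  refine congrArg₂ _ (by simp) (Finset.prod_congr rfl fun i hi => ?_)
  rw [if_neg (Finset.ne_of_mem_erase hi), Finset.card_univ]

/-- Two points at a large distance rarely have the same address. -/
theorem card_address_eq_mul_le (X Y : Coord j t r → Bool) (d : ℕ) :
    (Finset.univ.filter fun σ : Cell j → Bool => address σ X = address σ Y ∧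
      d ≤ (Finset.univ.filter fun p => content σ X p ≠ content σ Y p).card).card * 2 ^ d ≤
        Fintype.card (Cell j → Bool) := by
  classical
  -- Equal addresses force σ, at each cell of Δ, onto a position of its pair where X and Y agree: at
  -- most one of two. Since Δ contains every content difference, the event is empty when d exceeds
  -- |Δ|.
  set Δ : Finset (Cell j) := Finset.univ.filter fun p => ∃ b, X (pair p b) ≠ Y (pair p b) with hΔ
  have hsub : ∀ σ, (Finset.univ.filter fun p => content σ X p ≠ content σ Y p) ⊆ Δ := by
    intro σ p hp
    simp only [Finset.mem_filter, Finset.mem_univ, true_and, hΔ] at hp ⊢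
    exact ⟨_, hp⟩
  by_cases hd : d ≤ Δ.card
  swap
  · rw [Finset.filter_false_of_mem, Finset.card_empty, zero_mul]
    · exact Nat.zero_le _
    · exact fun σ _ h => hd (h.2.trans (Finset.card_le_card (hsub σ)))
  have h1 : (Finset.univ.filter fun σ : Cell j → Bool => address σ X = address σ Y ∧
      d ≤ (Finset.univ.filter fun p => content σ X p ≠ content σ Y p).card) ⊆
        Fintype.piFinset fun p =>
          Finset.univ.filter fun b => X (pair p b) = Y (pair p b) := by
    intro σ hσ
    simp only [Finset.mem_filter, Finset.mem_univ, true_and, Fintype.mem_piFinset] at hσ ⊢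
    exact fun p => congrFun (congrArg Prod.fst hσ.1) p
  have h2 : (Fintype.piFinset fun p : Cell j =>
      Finset.univ.filter fun b => X (pair p b) = Y (pair p b)).card * 2 ^ Δ.card ≤
        Fintype.card (Cell j → Bool) := by
    have h3 : 2 ^ Δ.card = ∏ p : Cell j, if p ∈ Δ then 2 else 1 := by
      rw [Finset.prod_ite_mem, Finset.univ_inter, Finset.prod_const]
    rw [Fintype.card_piFinset, h3, ← Finset.prod_mul_distrib, Fintype.card_pi]
    refine Finset.prod_le_prod' fun p _ => ?_
    split_ifs with hp
    · simp only [hΔ, Finset.mem_filter, Finset.mem_univ, true_and] at hp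
      obtain ⟨b, hb⟩ := hp
      have : (Finset.univ.filter fun b => X (pair p b) = Y (pair p b)).card <
          (Finset.univ : Finset Bool).card :=
        Finset.card_lt_card (Finset.filter_ssubset.2 ⟨b, Finset.mem_univ _, hb⟩)
      simp only [Finset.card_univ, Fintype.card_bool] at this ⊢
      omega
    · rw [mul_one]
      exact Finset.card_le_univ _
  calc _ ≤ _ := Nat.mul_le_mul (Finset.card_le_card h1) (Nat.pow_le_pow_right two_pos hd)
    _ ≤ _ := h2

/-- The expected advantage for a fixed set of active queries, when no two active queries with the
same address are far apart. -/
theorem sum_shift_acceptCount_sub_le {δ : ℝ} (hδ : |δ| ≤ 1 / 2) (σ : Cell j → Bool)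
    (X : Fin q → Coord j t r → Bool) (Act : Finset (Fin q)) (v : (Fin q → Bool) → Bool) (d : ℕ)
    (hgood : ∀ i ∈ Act, ∀ i' ∈ Act, address σ (X i) = address σ (X i') →
      (Finset.univ.filter fun p => content σ (X i) p ≠ content σ (X i') p).card ≤ d)
    {r₀ : ℝ} (hr₀ : 0 < r₀) {η : ℝ} (hη : 0 ≤ η)
    (hηr : ∀ m : ℕ, (m : ℝ) ≤ r₀ → 2 * √((1 + 4 * δ ^ 2) ^ m - 1) ≤ η) :
    ∑ ρ, (∑ A, biasProd (-δ) A * acceptCount σ ρ X Act v A -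
      ∑ A, biasProd δ A * acceptCount σ ρ X Act v A) ≤
        Fintype.card (Col j → Col j) * Fintype.card (Addr j → ZMod 2) *
          (η + d * Act.card / (2 ^ j * r₀)) := by
  classical
  -- One active representative per address; comparing each query with it alone costs a number of
  -- comparisons linear in the number of active queries, instead of quadratic.
  let rep : Addr j → Fin q → Fin q := fun α i =>
    if h : ∃ i' ∈ Act, address σ (X i') = α then h.choose else i
  have hrep : ∀ i ∈ Act, rep (address σ (X i)) i ∈ Act ∧
      address σ (X (rep (address σ (X i)) i)) = address σ (X i) := by
    intro i hi
    have h : ∃ i' ∈ Act, address σ (X i') = address σ (X i) := ⟨i, hi, rfl⟩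
    simp only [rep, dif_pos h]
    exact h.choose_spec
  have hrep' : ∀ i ∈ Act, ∀ i', rep (address σ (X i)) i' = rep (address σ (X i)) i := by
    intro i hi i'
    have h : ∃ i' ∈ Act, address σ (X i') = address σ (X i) := ⟨i, hi, rfl⟩
    simp only [rep, dif_pos h]
  let Δ : Fin q → Finset (Cell j) := fun i => Finset.univ.filter fun p =>
    content σ (X i) p ≠ content σ (X (rep (address σ (X i)) i)) p
  -- The difference sets `Δ i` do not involve ρ, so each of their cells is selected for exactly a
  -- fraction 2 ^ (-j) of the shifts.
  let R : (Col j → Col j) → Finset (Cell j) := fun ρ =>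
    Act.biUnion fun i => (Δ i).filter fun p => selected ρ (address σ (X i)).2 p.1 = p
  have hmem : ∀ ρ, ∀ i ∈ Act, ∀ m, selected ρ (address σ (X i)).2 m ∉ R ρ →
      content σ (X i) (selected ρ (address σ (X i)).2 m) =
        content σ (X (rep (address σ (X i)) i)) (selected ρ (address σ (X i)).2 m) := by
    intro ρ i hi m hm
    by_contra hne
    refine hm (Finset.mem_biUnion.2 ⟨i, hi, Finset.mem_filter.2 ⟨?_, rfl⟩⟩)
    exact Finset.mem_filter.2 ⟨Finset.mem_univ _, hne⟩
  have hdep : ∀ ρ, DependsOn (acceptCount σ ρ X Act v) (R ρ : Set (Cell j)) := fun ρ => by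
    refine dependsOn_acceptCount σ ρ X Act v (R ρ) fun i hi i' hi' h m hm => ?_
    rw [hmem ρ i hi m hm]
    have := hmem ρ i' hi' m (h ▸ hm)
    rw [← h, hrep' i hi i'] at this
    exact this.symm
  have hRcard : ∑ ρ, ((R ρ).card : ℝ) ≤ Fintype.card (Col j → Col j) * (d * Act.card / 2 ^ j) := by
    have h1 : ∀ ρ, ((R ρ).card : ℝ) ≤ ∑ i ∈ Act, ∑ p ∈ Δ i,
        if selected ρ (address σ (X i)).2 p.1 = p then (1 : ℝ) else 0 := by
      intro ρ
      have := Finset.card_biUnion_le (s := Act)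
        (t := fun i => (Δ i).filter fun p => selected ρ (address σ (X i)).2 p.1 = p)
      refine (Nat.cast_le.2 this).trans (le_of_eq ?_)
      simp only [Nat.cast_sum, Finset.sum_boole]
    refine (Finset.sum_le_sum fun ρ _ => h1 ρ).trans ?_
    rw [Finset.sum_comm]
    have h2 : ∀ i ∈ Act, ∑ ρ, ∑ p ∈ Δ i,
        (if selected ρ (address σ (X i)).2 p.1 = p then (1 : ℝ) else 0) ≤
          d * (Fintype.card (Col j → Col j) / 2 ^ j) := by
      intro i hi
      rw [Finset.sum_comm]
      have h3 : ∀ p : Cell j, ∑ ρ, (if selected ρ (address σ (X i)).2 p.1 = p then (1 : ℝ) else 0) =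
          Fintype.card (Col j → Col j) / 2 ^ j := fun p => by
        rw [Finset.sum_boole, eq_div_iff (by positivity)]
        exact_mod_cast card_selected_mul _ p
      simp only [h3, Finset.sum_const, nsmul_eq_mul]
      refine mul_le_mul_of_nonneg_right ?_ (div_nonneg (Nat.cast_nonneg _) (by positivity))
      have := hrep i hi
      exact_mod_cast hgood i hi _ this.1 this.2.symm
    refine (Finset.sum_le_sum h2).trans (le_of_eq ?_)
    rw [Finset.sum_const, nsmul_eq_mul]
    ring
  have h1 := Finset.sum_le_sum fun ρ (_ : ρ ∈ Finset.univ) =>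
    sum_acceptCount_sub_le hδ σ ρ X Act v (R ρ) (hdep ρ) hr₀ hη hηr
  refine h1.trans ?_
  rw [← Finset.mul_sum, Finset.sum_add_distrib, ← Finset.sum_div, Finset.sum_const,
    Finset.card_univ, nsmul_eq_mul]
  have h2 : (∑ ρ, ((R ρ).card : ℝ)) / r₀ ≤
      Fintype.card (Col j → Col j) * (d * Act.card / (2 ^ j * r₀)) := by
    rw [div_le_iff₀ hr₀]
    refine hRcard.trans (le_of_eq ?_)
    field_simp
  refine (mul_le_mul_of_nonneg_left (add_le_add le_rfl h2) (Nat.cast_nonneg _)).trans (le_of_eq ?_)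
  ring

/-- The three error terms are: a collision of distant queries (union bound over q² pairs), the
chi-square distance, and the expected number of exposed cells relative to r₀. -/
theorem sum_hardFun_accept_sub_le {δ : ℝ} (hδ : |δ| ≤ 1 / 2) (e : Coord j t r ↪ Fin n)
    (x : Fin q → Cube n) (v : (Fin q → Bool) → Bool) (d : ℕ)
    {r₀ : ℝ} (hr₀ : 0 < r₀) {η : ℝ} (hη : 0 ≤ η)
    (hηr : ∀ m : ℕ, (m : ℝ) ≤ r₀ → 2 * √((1 + 4 * δ ^ 2) ^ m - 1) ≤ η) :
    ∑ z, ∑ σ, ∑ ρ, ∑ b, ∑ A, (biasProd (-δ) A - biasProd δ A) *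
      (if v fun i => hardFun e z σ ρ b A (x i) then 1 else 0) ≤
        Fintype.card (Fin t → Bool) * Fintype.card (Cell j → Bool) *
          Fintype.card (Col j → Col j) * Fintype.card (Addr j → ZMod 2) *
            ((q : ℝ) ^ 2 / 2 ^ d + η + d * q / (2 ^ t * (2 ^ j * r₀))) := by
  classical
  let X : Fin q → Coord j t r → Bool := fun i => x i ∘ e
  let Act : (Fin t → Bool) → Finset (Fin q) := fun z =>
    Finset.univ.filter fun i => (fun k => X i (slot k)) = z
  set Nρ : ℝ := ((Fintype.card (Col j → Col j) : ℕ) : ℝ) with hNρ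
  set Nb : ℝ := ((Fintype.card (Addr j → ZMod 2) : ℕ) : ℝ) with hNb
  have hrew : ∀ z σ ρ, ∑ b, ∑ A, (biasProd (-δ) A - biasProd δ A) *
      (if v fun i => hardFun e z σ ρ b A (x i) then (1 : ℝ) else 0) =
        ∑ A, biasProd (-δ) A * acceptCount σ ρ X (Act z) v A -
          ∑ A, biasProd δ A * acceptCount σ ρ X (Act z) v A := by
    intro z σ ρ
    rw [Finset.sum_comm, ← Finset.sum_sub_distrib]
    refine Finset.sum_congr rfl fun A _ => ?_
    rw [← sub_mul, ← Finset.mul_sum]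
    refine congrArg _ (Finset.sum_congr rfl fun b _ => ?_)
    have : (fun i => hardFun e z σ ρ b A (x i)) =
        fun i => decide (i ∈ Act z ∧ hardVal σ ρ b A (X i) = 1) := by
      ext i
      simp [hardFun, Act, X, funext_iff]
    rw [this]
  simp only [hrew]
  let bad : (Cell j → Bool) → Prop := fun σ => ∃ i i', address σ (X i) = address σ (X i') ∧
    d ≤ (Finset.univ.filter fun p => content σ (X i) p ≠ content σ (X i') p).card
  have hbad : ∑ σ, (if bad σ then (1 : ℝ) else 0) ≤
      Fintype.card (Cell j → Bool) * ((q : ℝ) ^ 2 / 2 ^ d) := by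
    have h1 : ∀ σ, (if bad σ then (1 : ℝ) else 0) ≤ ∑ i, ∑ i',
        if address σ (X i) = address σ (X i') ∧
          d ≤ (Finset.univ.filter fun p => content σ (X i) p ≠ content σ (X i') p).card
        then (1 : ℝ) else 0 := by
      intro σ
      split_ifs with h
      · obtain ⟨i, i', h⟩ := h
        refine le_trans ?_ (Finset.single_le_sum (fun _ _ => Finset.sum_nonneg fun _ _ => by
          split_ifs <;> simp) (Finset.mem_univ i))
        refine le_trans ?_ (Finset.single_le_sum (fun _ _ => by
          split_ifs <;> simp) (Finset.mem_univ i'))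
        rw [if_pos h]
      · exact Finset.sum_nonneg fun _ _ => Finset.sum_nonneg fun _ _ => by split_ifs <;> simp
    refine (Finset.sum_le_sum fun σ _ => h1 σ).trans ?_
    rw [Finset.sum_comm]
    have h2 : ∀ i i', ∑ σ, (if address σ (X i) = address σ (X i') ∧
        d ≤ (Finset.univ.filter fun p => content σ (X i) p ≠ content σ (X i') p).card
          then (1 : ℝ) else 0) ≤ Fintype.card (Cell j → Bool) / 2 ^ d := by
      intro i i'
      rw [Finset.sum_boole, le_div_iff₀ (by positivity)]
      exact_mod_cast card_address_eq_mul_le (X i) (X i') d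
    have h3 : ∀ i, ∑ σ, ∑ i', (if address σ (X i) = address σ (X i') ∧
        d ≤ (Finset.univ.filter fun p => content σ (X i) p ≠ content σ (X i') p).card
          then (1 : ℝ) else 0) ≤ q * (Fintype.card (Cell j → Bool) / 2 ^ d) := by
      intro i
      rw [Finset.sum_comm]
      refine (Finset.sum_le_card_nsmul _ _ _ fun i' _ => h2 i i').trans (by simp)
    refine (Finset.sum_le_card_nsmul _ _ _ fun i _ => h3 i).trans (le_of_eq ?_)
    simp only [Finset.card_univ, Fintype.card_fin, nsmul_eq_mul]
    ring
  have hmain : ∀ z σ, ∑ ρ, (∑ A, biasProd (-δ) A * acceptCount σ ρ X (Act z) v A -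
      ∑ A, biasProd δ A * acceptCount σ ρ X (Act z) v A) ≤
        Nρ * Nb * ((if bad σ then 1 else 0) + (η + d * (Act z).card / (2 ^ j * r₀))) := by
    intro z σ
    split_ifs with h
    · refine (Finset.sum_le_card_nsmul _ _ _ fun ρ _ =>
        sum_acceptCount_sub_le_card hδ σ ρ X (Act z) v).trans ?_
      rw [nsmul_eq_mul, Finset.card_univ]
      have : (0 : ℝ) ≤ η + d * (Act z).card / (2 ^ j * r₀) := by positivity
      have h' : 0 ≤ Nρ * Nb := mul_nonneg (Nat.cast_nonneg _) (Nat.cast_nonneg _)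
      nlinarith
    · rw [zero_add]
      refine sum_shift_acceptCount_sub_le hδ σ X (Act z) v d (fun i _ i' _ hii => ?_) hr₀ hη hηr
      by_contra hlt
      exact h ⟨i, i', hii, (not_le.1 hlt).le⟩
  -- Each query is active for exactly one z; this is the source of the factor 2 ^ t.
  have hAct : ∑ z, ((Act z).card : ℝ) = q := by
    have := Finset.card_eq_sum_card_fiberwise (s := (Finset.univ : Finset (Fin q)))
      (t := Finset.univ) (f := fun i => fun k => X i (slot k)) (fun _ _ => by simp)
    rw [Finset.card_univ, Fintype.card_fin] at this
    exact_mod_cast this.symm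
  have hsum : ∀ z, ∑ σ, ∑ ρ, (∑ A, biasProd (-δ) A * acceptCount σ ρ X (Act z) v A -
      ∑ A, biasProd δ A * acceptCount σ ρ X (Act z) v A) ≤
        Nρ * Nb * (Fintype.card (Cell j → Bool) * ((q : ℝ) ^ 2 / 2 ^ d +
          (η + d * (Act z).card / (2 ^ j * r₀)))) := by
    intro z
    refine (Finset.sum_le_sum fun σ _ => hmain z σ).trans ?_
    rw [← Finset.mul_sum, Finset.sum_add_distrib, Finset.sum_const, nsmul_eq_mul, Finset.card_univ]
    refine mul_le_mul_of_nonneg_left ?_ (mul_nonneg (Nat.cast_nonneg _) (Nat.cast_nonneg _))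
    refine (add_le_add hbad le_rfl).trans (le_of_eq ?_)
    ring
  refine (Finset.sum_le_sum fun z _ => hsum z).trans (le_of_eq ?_)
  have hlin : ∀ z, Nρ * Nb * (Fintype.card (Cell j → Bool) * ((q : ℝ) ^ 2 / 2 ^ d +
      (η + d * (Act z).card / (2 ^ j * r₀)))) =
        Nρ * Nb * (Fintype.card (Cell j → Bool) * ((q : ℝ) ^ 2 / 2 ^ d + η)) +
          Nρ * Nb * (Fintype.card (Cell j → Bool) * (d / (2 ^ j * r₀))) * (Act z).card := by
    intro z; ring
  rw [Finset.sum_congr rfl fun z _ => hlin z, Finset.sum_add_distrib, Finset.sum_const,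
    ← Finset.mul_sum, hAct]
  have ht : ((Fintype.card (Fin t → Bool) : ℕ) : ℝ) = 2 ^ t := by simp
  rw [Finset.card_univ, nsmul_eq_mul, ht]
  field_simp

end Indistinguishable

/-! ### Effect of a single flip on the hard value -/

section Sensitivity

open Coord

variable {j t r n : ℕ}

theorem bit_not (b : Bool) : bit (!b) = bit b + 1 := by cases b <;> decide

theorem sum_bit_flipAt_of_mem {ι κ : Type*} [Fintype ι] [DecidableEq κ] (X : κ → Bool) (g : ι → κ)
    (hg : Function.Injective g) (i : ι) :
    ∑ i', bit (flipAt X (g i) (g i')) = ∑ i', bit (X (g i')) + 1 := by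
  classical
  rw [← Finset.add_sum_erase _ _ (Finset.mem_univ i),
    ← Finset.add_sum_erase _ (fun i' => bit (X (g i'))) (Finset.mem_univ i), flipAt_self, bit_not,
    Finset.sum_congr rfl fun i' hi' =>
      congrArg bit (flipAt_of_ne X fun h => Finset.ne_of_mem_erase hi' (hg h))]
  ring

theorem address_flipAt_inr_inr (σ : Cell j → Bool) (X : Coord j t r → Bool)
    (c : Fin t ⊕ Fin (r + 1) ⊕ Unit) :
    address σ (flipAt X (.inr (.inr c))) = address σ X := by
  simp [address, flipAt_of_ne]

theorem address_flipAt_content (σ : Cell j → Bool) (X : Coord j t r → Bool) (p : Cell j) :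
    address σ (flipAt X (pair p (!σ p))) = address σ X := by
  refine Prod.ext (funext fun p' => ?_) (funext fun i => funext fun k => ?_)
  · refine flipAt_of_ne _ fun h => ?_
    simp only [Sum.inl.injEq, Prod.mk.injEq] at h
    obtain ⟨rfl, h⟩ := h
    cases h' : σ p' <;> simp [h'] at h
  · exact flipAt_of_ne X (i := pair p (!σ p)) Sum.inr_ne_inl

theorem content_flipAt_inr (σ : Cell j → Bool) (X : Coord j t r → Bool) (c : Aux j t r) :
    content σ (flipAt X (.inr c)) = content σ X :=
  funext fun _ => flipAt_of_ne _ (by simp)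

theorem cellSum_flipAt_inr_inr (σ : Cell j → Bool) (ρ : Col j → Col j) (A : Cell j → Bool)
    (X : Coord j t r → Bool) (c : Fin t ⊕ Fin (r + 1) ⊕ Unit) :
    cellSum σ ρ A (flipAt X (.inr (.inr c))) = cellSum σ ρ A X := by
  simp only [cellSum, address_flipAt_inr_inr, content_flipAt_inr]

theorem hardVal_flipAt_par (σ : Cell j → Bool) (ρ : Col j → Col j) (b : Addr j → ZMod 2)
    (A : Cell j → Bool) (X : Coord j t r → Bool) (i : Fin (r + 1)) :
    hardVal σ ρ b A (flipAt X (par i)) = hardVal σ ρ b A X + 1 := by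
  have h := sum_bit_flipAt_of_mem X (fun i : Fin (r + 1) => (par i : Coord j t r))
    (fun a b h => by simpa using h) i
  have h2 : flipAt X (par i) switch = X switch := flipAt_of_ne _ (by simp)
  simp only [hardVal, cellSum_flipAt_inr_inr, address_flipAt_inr_inr, mask, h, h2]
  ring

theorem hardVal_flipAt_switch (σ : Cell j → Bool) (ρ : Col j → Col j) (b : Addr j → ZMod 2)
    (A : Cell j → Bool) (X : Coord j t r → Bool) :
    hardVal σ ρ b A (flipAt X switch) = hardVal σ ρ b A X + addrParity (address σ X) := by
  have h : ∀ i : Fin (r + 1), flipAt X switch (par i) = X (par i) := fun i =>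
    flipAt_of_ne _ (by simp)
  simp only [hardVal, cellSum_flipAt_inr_inr, address_flipAt_inr_inr, mask, h, flipAt_self, bit_not]
  ring

theorem addrParity_flipAt_address (σ : Cell j → Bool) (X : Coord j t r → Bool) (p : Cell j) :
    addrParity (address σ (flipAt X (pair p (σ p)))) = addrParity (address σ X) + 1 := by
  have h := sum_bit_flipAt_of_mem X (fun p => (pair p (σ p) : Coord j t r))
    (fun a b h => by simp at h; exact h.1) p
  have h2 : ∀ u : Col j × Fin j, flipAt X (pair p (σ p)) (sel u.1 u.2) = X (sel u.1 u.2) :=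
    fun u => flipAt_of_ne _ (by simp)
  simp only [addrParity, address, h, h2]
  ring

theorem addrParity_flipAt_sel (σ : Cell j → Bool) (X : Coord j t r → Bool) (i : Col j)
    (k : Fin j) :
    addrParity (address σ (flipAt X (sel i k))) = addrParity (address σ X) + 1 := by
  have h := sum_bit_flipAt_of_mem X (fun u : Col j × Fin j => (sel u.1 u.2 : Coord j t r))
    (fun a b h => by simpa [Prod.ext_iff] using h) (i, k)
  have h2 : ∀ p, flipAt X (sel i k) (pair p (σ p)) = X (pair p (σ p)) :=
    fun u => flipAt_of_ne _ (by simp)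
  simp only [addrParity, address, h, h2]
  ring

/-- A content flip leaves the address, hence the selection, unchanged. Selected cells lie in
distinct rows, so exactly one summand changes. -/
theorem hardVal_flipAt_content (σ : Cell j → Bool) (ρ : Col j → Col j) (b : Addr j → ZMod 2)
    (A : Cell j → Bool) (X : Coord j t r → Bool) (i : Col j)
    (hA : A (selected ρ (address σ X).2 i)) :
    hardVal σ ρ b A (flipAt X (pair (selected ρ (address σ X).2 i)
      (!σ (selected ρ (address σ X).2 i)))) = hardVal σ ρ b A X + 1 := by
  set p := selected ρ (address σ X).2 i with hp
  have hm : mask σ (flipAt X (pair p (!σ p))) = mask σ X := by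
    have h : ∀ i : Fin (r + 1), flipAt X (pair p (!σ p)) (par i) = X (par i) := fun i =>
      flipAt_of_ne _ (by simp)
    have h2 : flipAt X (pair p (!σ p)) switch = X switch := flipAt_of_ne _ (by simp)
    simp only [mask, address_flipAt_content, h, h2]
  have hc : cellSum σ ρ A (flipAt X (pair p (!σ p))) = cellSum σ ρ A X + 1 := by
    simp only [cellSum, address_flipAt_content]
    rw [← Finset.add_sum_erase _ _ (Finset.mem_univ i),
      ← Finset.add_sum_erase Finset.univ (fun i => bit (A (selected ρ (address σ X).2 i)) *
        bit (content σ X (selected ρ (address σ X).2 i))) (Finset.mem_univ i), ← hp]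
    have h1 : content σ (flipAt X (pair p (!σ p))) p = !content σ X p := flipAt_self _ _
    have h2 : ∀ i' ∈ Finset.univ.erase i,
        content σ (flipAt X (pair p (!σ p))) (selected ρ (address σ X).2 i') =
          content σ X (selected ρ (address σ X).2 i') := fun i' hi' =>
      flipAt_of_ne _ fun h => by
        simp only [Sum.inl.injEq, Prod.mk.injEq] at h
        exact Finset.ne_of_mem_erase hi' (congrArg Prod.fst h.1)
    rw [Finset.sum_congr rfl fun i' hi' => by rw [h2 i' hi'], h1, bit_not, hA]
    simp only [bit, if_true]
    ring
  simp only [hardVal, address_flipAt_content, hm, hc]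
  ring

end Sensitivity

/-! ### Juntas and distance from juntas -/

section Distance

open Coord

variable {j t r n : ℕ} (e : Coord j t r ↪ Fin n) (z : Fin t → Bool) (σ : Cell j → Bool)
  (ρ : Col j → Col j) (b : Addr j → ZMod 2) (A : Cell j → Bool)

/-- The hard function depends only on the auxiliary coordinates, on the address bits and on the
contents of the cells in `A`. -/
theorem isJunta_hardFun {k : ℕ}
    (hA : Fintype.card (Cell j) + Fintype.card (Aux j t r) +
      (Finset.univ.filter fun p => A p).card ≤ k) :
    IsJunta k (hardFun e z σ ρ b A) := by
  classical
  let S : Finset (Coord j t r) := (Finset.univ.image fun p => pair p (σ p)) ∪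
    Finset.univ.image Sum.inr ∪
      (Finset.univ.filter fun p => A p).image fun p => pair p (!σ p)
  have hS : S.card ≤ k := by
    refine le_trans ?_ hA
    refine (Finset.card_union_le _ _).trans (add_le_add ((Finset.card_union_le _ _).trans
      (add_le_add ?_ ?_)) Finset.card_image_le)
    · exact Finset.card_image_le
    · exact Finset.card_image_le
  refine ⟨S.map e, by rwa [Finset.card_map], fun x y hxy => ?_⟩
  have hX : ∀ c ∈ S, (x ∘ e) c = (y ∘ e) c := fun c hc =>
    hxy (e c) (by simpa using hc)
  have haux : ∀ c : Aux j t r, (x ∘ e) (.inr c) = (y ∘ e) (.inr c) := fun c =>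
    hX _ (by simp [S])
  have hadr : address σ (x ∘ e) = address σ (y ∘ e) :=
    Prod.ext (funext fun p => hX _ (by simp [S])) (funext fun i => funext fun k => haux _)
  have hcont : ∀ p, bit (A p) * bit (content σ (x ∘ e) p) =
      bit (A p) * bit (content σ (y ∘ e) p) := fun p => by
    by_cases hp : A p
    · have : content σ (x ∘ e) p = content σ (y ∘ e) p :=
        hX _ (Finset.mem_union_right _ (Finset.mem_image.2 ⟨p, by simpa using hp, rfl⟩))
      rw [this]
    · simp [bit, hp]
  have hval : hardVal σ ρ b A (x ∘ e) = hardVal σ ρ b A (y ∘ e) := by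
    simp only [hardVal, mask, cellSum, hadr, hcont, haux]
  have hslot : ∀ i : Fin t, x (e (slot i)) = y (e (slot i)) := fun i => haux _
  simp only [hardFun, hval, hslot]

theorem zmod_two_eq_one_iff_of_ne {u w : ZMod 2} (h : u ≠ w) : ¬ (u = 1 ↔ w = 1) := by
  revert u w; decide

theorem slot_flipAt {x : Cube n} (hx : ∀ i, x (e (slot i)) = z i) {c : Coord j t r}
    (hc : ∀ i, c ≠ slot i) (i : Fin t) : flipAt x (e c) (e (slot i)) = z i := by
  rw [flipAt_of_ne _ fun h => hc i (e.injective h).symm, hx]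

theorem hardFun_ne_of_hardVal_ne {x : Cube n} {c : Coord j t r}
    (hx : ∀ i, x (e (slot i)) = z i) (hc : ∀ i, c ≠ slot i)
    (h : hardVal σ ρ b A (x ∘ e) ≠ hardVal σ ρ b A (flipAt (x ∘ e) c)) :
    hardFun e z σ ρ b A x ≠ hardFun e z σ ρ b A (flipAt x (e c)) := by
  have hx' := slot_flipAt e z hx hc
  have := zmod_two_eq_one_iff_of_ne h
  simp only [hardFun, flipAt_comp, hx, hx', ne_eq, decide_eq_decide, implies_true, true_and]
  exact this

/-- A parity bit shows that the function is 1 on half of the subcube, and negating a slot bit leaves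
the subcube, where the function is 0. -/
theorem card_slot_le_of_slot (i : Fin t) :
    (Finset.univ.filter fun x : Cube n => ∀ i, x (e (slot i)) = z i).card ≤
      2 * (Finset.univ.filter fun x =>
        hardFun e z σ ρ b A x ≠ hardFun e z σ ρ b A (flipAt x (e (slot i)))).card := by
  refine (card_le_two_mul_card_and_of_toggle _ (fun x => hardVal σ ρ b A (x ∘ e) = 1)
    (e (par 0)) (fun x hx => slot_flipAt e z hx (by simp)) fun x hx h => ?_).trans
      (Nat.mul_le_mul_left _ (Finset.card_le_card fun x hx => ?_))
  · rw [flipAt_comp, hardVal_flipAt_par]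
    revert h
    generalize hardVal σ ρ b A (x ∘ e) = u
    revert u; decide
  · simp only [Finset.mem_filter, Finset.mem_univ, true_and] at hx ⊢
    have h1 : hardFun e z σ ρ b A x = true := decide_eq_true hx
    have h2 : hardFun e z σ ρ b A (flipAt x (e (slot i))) = false := by
      refine decide_eq_false fun h => ?_
      have := h.1 i
      rw [flipAt_self, hx.1 i] at this
      cases h' : z i <;> simp [h'] at this
    rw [h1, h2]
    simp

theorem card_slot_le_of_par (i : Fin (r + 1)) :
    (Finset.univ.filter fun x : Cube n => ∀ i, x (e (slot i)) = z i).card ≤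
      (Finset.univ.filter fun x =>
        hardFun e z σ ρ b A x ≠ hardFun e z σ ρ b A (flipAt x (e (par i)))).card := by
  refine Finset.card_le_card fun x hx => ?_
  simp only [Finset.mem_filter, Finset.mem_univ, true_and] at hx ⊢
  refine hardFun_ne_of_hardVal_ne e z σ ρ b A hx (by simp) ?_
  rw [hardVal_flipAt_par]
  exact (add_ne_left.2 one_ne_zero).symm

/-- The switch acts exactly where the address parity is odd, and flipping any address bit toggles
that parity. -/
theorem card_slot_le_of_switch :
    (Finset.univ.filter fun x : Cube n => ∀ i, x (e (slot i)) = z i).card ≤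
      2 * (Finset.univ.filter fun x =>
        hardFun e z σ ρ b A x ≠ hardFun e z σ ρ b A (flipAt x (e switch))).card := by
  let p : Cell j := (fun _ => false, fun _ => false)
  refine (card_le_two_mul_card_and_of_toggle _ (fun x => addrParity (address σ (x ∘ e)) ≠ 0)
    (e (pair p (σ p))) (fun x hx => slot_flipAt e z hx (by simp)) fun x hx h => ?_).trans
      (Nat.mul_le_mul_left _ (Finset.card_le_card fun x hx => ?_))
  · rw [not_not] at h
    rw [flipAt_comp, addrParity_flipAt_address, h]
    decide
  · simp only [Finset.mem_filter, Finset.mem_univ, true_and] at hx ⊢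
    refine hardFun_ne_of_hardVal_ne e z σ ρ b A hx.1 (by simp) ?_
    rw [hardVal_flipAt_switch]
    exact (add_ne_left.2 hx.2).symm

/-- Negating a coordinate that changes the parity of the address changes the value at one of the
two positions of the switch. -/
theorem card_slot_le_of_address (c : Coord j t r) (hc : ∀ i, c ≠ slot i)
    (hpar : ∀ X : Coord j t r → Bool,
      addrParity (address σ (flipAt X c)) = addrParity (address σ X) + 1) :
    (Finset.univ.filter fun x : Cube n => ∀ i, x (e (slot i)) = z i).card ≤
      2 * (Finset.univ.filter fun x =>
        hardFun e z σ ρ b A x ≠ hardFun e z σ ρ b A (flipAt x (e c))).card := by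
  refine (card_le_two_mul_card_and_of_toggle _
    (fun x => hardVal σ ρ b A (x ∘ e) ≠ hardVal σ ρ b A (flipAt (x ∘ e) c))
    (e switch) (fun x hx => slot_flipAt e z hx (by simp)) fun x hx h => ?_).trans
      (Nat.mul_le_mul_left _ (Finset.card_le_card fun x hx => ?_))
  -- The switch adds the address parity to the value. The parities at X and at its flip along c
  -- differ by 1, so toggling the switch toggles the derivative along c.
  · rw [not_not] at h
    rw [flipAt_comp, flipAt_comm, hardVal_flipAt_switch, hardVal_flipAt_switch, hpar, h,
      ← add_assoc]
    exact (add_ne_left.2 one_ne_zero).symm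
  · simp only [Finset.mem_filter, Finset.mem_univ, true_and] at hx ⊢
    exact hardFun_ne_of_hardVal_ne e z σ ρ b A hx.1 hc hx.2

/-- A set of cells that is as large as a row is missed by at most two thirds of the selections. -/
theorem card_miss_le (A' : Finset (Cell j)) (hA' : 2 ^ j ≤ A'.card) :
    3 * (Finset.univ.filter fun c : Col j → Col j => ∀ i, selected ρ c i ∉ A').card ≤
      2 * Fintype.card (Col j → Col j) := by
  classical
  let a : Col j → ℕ := fun i => (Finset.univ.filter fun w : Col j => (i, w) ∈ A').card
  have h1 : (Finset.univ.filter fun c : Col j → Col j => ∀ i, selected ρ c i ∉ A') =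
      Fintype.piFinset fun i =>
        Finset.univ.filter fun w : Col j => (i, fun k => xor (w k) (ρ i k)) ∉ A' := by
    ext c
    rw [Finset.mem_filter]
    simp only [Finset.mem_filter, Finset.mem_univ, true_and, Fintype.mem_piFinset, selected]
  have h2 : ∀ i, ((Finset.univ.filter fun w : Col j =>
      (i, fun k => xor (w k) (ρ i k)) ∉ A').card : ℝ) = 2 ^ j - a i := by
    intro i
    have hbij : (Finset.univ.filter fun w : Col j => (i, fun k => xor (w k) (ρ i k)) ∉ A').card =
        (Finset.univ.filter fun w : Col j => (i, w) ∉ A').card := by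
      have hxx : ∀ w : Col j, (fun k => xor (xor (w k) (ρ i k)) (ρ i k)) = w := fun w => by
        ext k; simp
      refine Finset.card_bij' (fun w _ k => xor (w k) (ρ i k)) (fun w _ k => xor (w k) (ρ i k))
        ?_ ?_ (fun w _ => hxx w) (fun w _ => hxx w)
      · intro w hw
        simpa using hw
      · intro w hw
        simp only [Finset.mem_filter, Finset.mem_univ, true_and] at hw ⊢
        rwa [hxx]
    have := Finset.card_filter_add_card_filter_not (s := (Finset.univ : Finset (Col j)))
      (fun w => (i, w) ∈ A')
    rw [hbij]
    have h3 : (Finset.univ : Finset (Col j)).card = 2 ^ j := by simp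
    rw [h3] at this
    have h4 : ((a i : ℕ) : ℝ) + ((Finset.univ.filter fun w : Col j => (i, w) ∉ A').card : ℝ) =
        2 ^ j := by exact_mod_cast this
    linarith
  have hsum : ∑ i, (a i : ℝ) = A'.card := by
    have := Finset.card_eq_sum_card_fiberwise (s := A') (t := Finset.univ) (f := Prod.fst)
      (fun _ _ => by simp)
    rw [this]
    push_cast
    refine Finset.sum_congr rfl fun i _ => ?_
    have : (A'.filter fun p => p.1 = i).card = a i := by
      symm
      refine Finset.card_bij (fun w _ => (i, w)) ?_ ?_ ?_
      · intro w hw; simpa using hw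
      · intro w _ w' _ h; simpa using h
      · rintro ⟨i', w⟩ h
        simp only [Finset.mem_filter] at h
        obtain ⟨h, rfl⟩ := h
        exact ⟨w, by simpa using h, rfl⟩
    rw [this]
  have hs : (0 : ℝ) < 2 ^ j := by positivity
  have h5 : ((Finset.univ.filter fun c : Col j → Col j => ∀ i, selected ρ c i ∉ A').card : ℝ) ≤
      (2 / 3) * Fintype.card (Col j → Col j) := by
    rw [h1, Fintype.card_piFinset, Nat.cast_prod, Fintype.card_pi, Nat.cast_prod]
    simp only [h2]
    -- From 1 - u ≤ exp(-u): the product over rows is at most exp(-|A'| / 2 ^ j) ≤ 1/e < 2/3.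
    have h6 : ∀ i, (2 ^ j - a i : ℝ) ≤ Real.exp (-(a i / 2 ^ j)) * Fintype.card (Col j) := by
      intro i
      have h7 := Real.add_one_le_exp (-(a i / 2 ^ j : ℝ))
      have h8 : ((Fintype.card (Col j) : ℕ) : ℝ) = 2 ^ j := by simp
      rw [h8]
      calc (2 ^ j - a i : ℝ) = (-(a i / 2 ^ j) + 1) * 2 ^ j := by field_simp; ring
        _ ≤ _ := mul_le_mul_of_nonneg_right h7 hs.le
    refine (Finset.prod_le_prod (fun i _ => ?_) fun i _ => h6 i).trans ?_
    · rw [← h2]; exact Nat.cast_nonneg _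
    rw [Finset.prod_mul_distrib, ← Real.exp_sum, Finset.sum_neg_distrib, ← Finset.sum_div, hsum]
    refine mul_le_mul_of_nonneg_right ?_ (Finset.prod_nonneg fun _ _ => Nat.cast_nonneg _)
    have h9 : (1 : ℝ) ≤ A'.card / 2 ^ j := by
      rw [one_le_div hs]; exact_mod_cast hA'
    calc Real.exp (-(A'.card / 2 ^ j)) ≤ Real.exp (-1) := Real.exp_le_exp.2 (by linarith)
      _ ≤ 2 / 3 := by
        rw [Real.exp_neg, inv_le_comm₀ (Real.exp_pos 1) (by norm_num)]
        linarith [Real.add_one_le_exp (1 : ℝ)]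
  have h10 : (3 * (Finset.univ.filter fun c : Col j → Col j => ∀ i, selected ρ c i ∉ A').card : ℝ) ≤
      2 * Fintype.card (Col j → Col j) := by linarith
  exact_mod_cast h10

/-- The selectors are equidistributed over the points with given slot bits. -/
theorem exists_card_slot_and_eq : ∃ F : ℕ, ∀ (Q : (Col j → Col j) → Prop) [DecidablePred Q],
    (Finset.univ.filter fun x : Cube n => (∀ i, x (e (slot i)) = z i) ∧
      Q (address σ (x ∘ e)).2).card = F * (Finset.univ.filter Q).card := by
  classical
  let φ : Fin t ⊕ (Col j × Fin j) ↪ Fin n :=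
    ⟨fun u => e (Sum.elim (fun i => slot i) (fun u => sel u.1 u.2) u), fun u u' h => by
      have := e.injective h
      rcases u with u | u <;> rcases u' with u' | u' <;> simp_all [Prod.ext_iff]⟩
  let F : ℕ := (Finset.univ.filter fun x : Cube n => x ∘ φ = fun _ => false).card
  refine ⟨F, fun Q _ => ?_⟩
  have hF : ∀ v, (Finset.univ.filter fun x : Cube n => x ∘ φ = v).card = F := fun v =>
    Nat.eq_of_mul_eq_mul_right (by positivity)
      ((card_filter_comp_eq_mul φ v).trans (card_filter_comp_eq_mul φ _).symm)
  rw [Finset.card_eq_sum_card_fiberwise (f := fun x => (address σ (x ∘ e)).2)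
    (t := Finset.univ.filter Q) (fun x hx => by simpa using (by simpa using hx : _ ∧ _).2),
    mul_comm, ← smul_eq_mul, ← Finset.sum_const]
  refine Finset.sum_congr rfl fun c hc => ?_
  rw [← hF (Sum.elim z fun u => c u.1 u.2)]
  congr 1
  ext x
  simp only [Finset.mem_filter, Finset.mem_univ, true_and] at hc ⊢
  constructor
  · rintro ⟨⟨h1, _⟩, h2⟩
    funext u
    rcases u with u | u
    · exact h1 u
    · exact congrFun (congrFun h2 u.1) u.2
  · intro h
    have h2 : (address σ (x ∘ e)).2 = c := funext fun i => funext fun k => congrFun h (.inr (i, k))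
    exact ⟨⟨fun i => congrFun h (.inl i), h2 ▸ hc⟩, h2⟩

theorem card_slot_mul :
    (Finset.univ.filter fun x : Cube n => ∀ i, x (e (slot i)) = z i).card * 2 ^ t = 2 ^ n := by
  have := card_filter_comp_eq_mul (⟨fun i => e (slot i), fun i i' h => by
    simpa using e.injective h⟩ : Fin t ↪ Fin n) z
  rw [Fintype.card_fin, Fintype.card_fin] at this
  rw [← this]
  congr 3
  ext x
  simp only [funext_iff]
  rfl

/-- Ignoring an auxiliary or address coordinate costs at least a quarter of the subcube. Otherwise
some selected cell has an ignored content for at least a third of the selections, and each sensitive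
pair contains an error, which gives a sixth. -/
theorem card_slot_le_six_mul_hammingDist {k : ℕ}
    (hA : k + 2 ^ j ≤ Fintype.card (Cell j) + Fintype.card (Aux j t r) +
      (Finset.univ.filter fun p => A p).card) (g : Cube n → Bool) (hg : IsJunta k g) :
    (Finset.univ.filter fun x : Cube n => ∀ i, x (e (slot i)) = z i).card ≤
      6 * hammingDist (hardFun e z σ ρ b A) g := by
  classical
  obtain ⟨J, hJk, hJ⟩ := hg
  set f := hardFun e z σ ρ b A with hf
  have hconst : ∀ c, e c ∉ J →
      (Finset.univ.filter fun x => f x ≠ f (flipAt x (e c))).card ≤ 2 * hammingDist f g :=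
    fun c hc => card_sensitive_le_two_mul_hammingDist f g J hJ (fun _ => e c) (fun _ => by simpa)
      fun _ => rfl
  by_cases haux : ∀ c : Aux j t r, e (.inr c) ∈ J
  swap
  · push Not at haux
    obtain ⟨c, hc⟩ := haux
    have h1 := hconst _ hc
    rcases c with c | c | c | c
    · have := card_slot_le_of_address e z σ ρ b A (sel c.1 c.2) (by simp)
        (fun X => addrParity_flipAt_sel σ X c.1 c.2)
      rw [← hf] at this
      have := this.trans (Nat.mul_le_mul_left 2 h1)
      omega
    · have := (card_slot_le_of_slot e z σ ρ b A c).trans (Nat.mul_le_mul_left 2 h1)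
      omega
    · have := (card_slot_le_of_par e z σ ρ b A c).trans h1
      omega
    · have := (card_slot_le_of_switch e z σ ρ b A).trans (Nat.mul_le_mul_left 2 h1)
      omega
  by_cases hadr : ∀ p, e (pair p (σ p)) ∈ J
  swap
  · push Not at hadr
    obtain ⟨p, hp⟩ := hadr
    have := (card_slot_le_of_address e z σ ρ b A (pair p (σ p)) (by simp)
      (fun X => addrParity_flipAt_address σ X p)).trans (Nat.mul_le_mul_left 2 (hconst _ hp))
    omega
  set A' : Finset (Cell j) := Finset.univ.filter fun p => A p ∧ e (pair p (!σ p)) ∉ J with hA'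
  have hA'card : 2 ^ j ≤ A'.card := by
    -- All these distinct coordinates lie in J, so at most k - |cells| - |aux| cells of A have their
    -- content in J; at least 2 ^ j remain.
    let ψ : Cell j ⊕ Aux j t r ⊕ {p // A p ∧ e (pair p (!σ p)) ∈ J} → {i // i ∈ J} :=
      Sum.elim (fun p => ⟨_, hadr p⟩) (Sum.elim (fun c => ⟨_, haux c⟩) fun p => ⟨_, p.2.2⟩)
    have hψ : Function.Injective ψ := by
      rintro (p | c | p) (p' | c' | p') h <;>
        simp only [ψ, Sum.elim_inl, Sum.elim_inr, Subtype.mk.injEq, e.injective.eq_iff,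
          Sum.inl.injEq, Sum.inr.injEq, Prod.mk.injEq, reduceCtorEq] at h
      · rw [h.1]
      · obtain ⟨h1, h2⟩ := h
        subst h1
        cases h' : σ p'.1 <;> simp [h'] at h2
      · rw [h]
      · obtain ⟨h1, h2⟩ := h
        subst h1
        cases h' : σ p.1 <;> simp [h'] at h2
      · rw [Subtype.ext h.1]
    have h1 := Fintype.card_le_of_injective ψ hψ
    rw [Fintype.card_sum, Fintype.card_sum, Fintype.card_coe, Fintype.card_subtype] at h1
    have h2 := Finset.card_filter_add_card_filter_not
      (s := Finset.univ.filter fun p => A p) (fun p => e (pair p (!σ p)) ∈ J)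
    rw [Finset.filter_filter, Finset.filter_filter] at h2
    rw [hA']
    omega
  have hne : A'.Nonempty := Finset.card_pos.1 (lt_of_lt_of_le (by positivity) hA'card)
  obtain ⟨p₀, hp₀⟩ := hne
  -- The chosen cell depends only on the selectors, so flipping its content preserves the choice.
  -- The default p₀ keeps the coordinate outside J when no cell of A' is selected.
  let pick : (Col j → Col j) → Cell j := fun c =>
    if h : ∃ i, selected ρ c i ∈ A' then selected ρ c h.choose else p₀
  have hpick : ∀ c, pick c ∈ A' := fun c => by
    simp only [pick]
    split_ifs with h
    · exact h.choose_spec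
    · exact hp₀
  let E : Cube n → Fin n := fun x =>
    e (pair (pick (address σ (x ∘ e)).2) (!σ (pick (address σ (x ∘ e)).2)))
  have h1 := card_sensitive_le_two_mul_hammingDist f g J hJ E
    (fun x => by have := hpick (address σ (x ∘ e)).2; simp [hA'] at this; simpa [E] using this.2)
    (fun x => by simp only [E, flipAt_comp, address_flipAt_content])
  have h2 : (Finset.univ.filter fun x : Cube n => (∀ i, x (e (slot i)) = z i) ∧
      ¬ ∀ i, selected ρ (address σ (x ∘ e)).2 i ∉ A').card ≤
        (Finset.univ.filter fun x => f x ≠ f (flipAt x (E x))).card := by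
    refine Finset.card_le_card fun x hx => ?_
    simp only [Finset.mem_filter, Finset.mem_univ, true_and, not_forall, not_not] at hx ⊢
    obtain ⟨hx, h⟩ := hx
    have hp : pick (address σ (x ∘ e)).2 = selected ρ (address σ (x ∘ e)).2 h.choose := by
      simp only [pick, dif_pos h]
    have hm := h.choose_spec
    refine hardFun_ne_of_hardVal_ne e z σ ρ b A hx (by simp) ?_
    rw [hp, hardVal_flipAt_content σ ρ b A _ _ (Finset.mem_filter.1 hm).2.1]
    exact (add_ne_left.2 one_ne_zero).symm
  obtain ⟨F, hF⟩ := exists_card_slot_and_eq e z σ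
  have h3 := hF fun c => ∀ i, selected ρ c i ∉ A'
  have h4 := hF fun _ => True
  have h5 := hF fun c => ¬ ∀ i, selected ρ c i ∉ A'
  have h6 := card_miss_le ρ A' hA'card
  have h7 := Finset.card_filter_add_card_filter_not (s := Finset.univ)
    (fun c : Col j → Col j => ∀ i, selected ρ c i ∉ A')
  simp only [and_true, Finset.filter_true] at h4
  rw [Finset.card_univ] at h4 h7
  have h8 : Fintype.card (Col j → Col j) ≤ 3 * (Finset.univ.filter fun c : Col j → Col j =>
      ¬ ∀ i, selected ρ c i ∉ A').card := by omega
  have h9 := Nat.mul_le_mul_left F h8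
  rw [← h4, Nat.mul_left_comm, ← h5] at h9
  omega

theorem farFromJuntas_hardFun {k : ℕ} {ε : ℝ} (hε : ε * 6 * 2 ^ t ≤ 1)
    (hA : k + 2 ^ j ≤ Fintype.card (Cell j) + Fintype.card (Aux j t r) +
      (Finset.univ.filter fun p => A p).card) :
    FarFromJuntas k ε (hardFun e z σ ρ b A) := by
  intro g hg
  have h1 : ((Finset.univ.filter fun x : Cube n => ∀ i, x (e (slot i)) = z i).card : ℝ) ≤
      6 * hammingDist (hardFun e z σ ρ b A) g := by
    exact_mod_cast card_slot_le_six_mul_hammingDist e z σ ρ b A hA g hg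
  have h2 : ((Finset.univ.filter fun x : Cube n => ∀ i, x (e (slot i)) = z i).card : ℝ) * 2 ^ t =
      2 ^ n := by exact_mod_cast card_slot_mul e z
  have h3 : (0 : ℝ) ≤ (Finset.univ.filter fun x : Cube n => ∀ i, x (e (slot i)) = z i).card :=
    Nat.cast_nonneg _
  rw [← h2]
  nlinarith

end Distance

/-! ### Query lower bounds from the two constructions -/

section LowerBounds

open Coord

/-- The hard functions force a tester to make many queries. -/
theorem pow_le_mul_queries_of_tester {j t r n k h q d : ℕ} {ε : ℝ} (hj : 3 ≤ j)
    (e : Coord j t r ↪ Fin n) (hh : 2 * h = Fintype.card (Cell j))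
    (hk : k = Fintype.card (Cell j) + Fintype.card (Aux j t r) + h) (hε : ε * 6 * 2 ^ t ≤ 1)
    (𝒜 : NonadaptiveAlg n) (h𝒜 : IsJuntaTester k ε 𝒜) (hq : QueriesAtMost 𝒜 q)
    (hd : 16 * (q : ℝ) ^ 2 ≤ 2 ^ d) :
    (2 : ℝ) ^ t * (2 ^ j) ^ 3 ≤ 18000 * d * q := by
  classical
  set s : ℝ := 2 ^ j with hs
  have hs8 : 8 ≤ s := by
    calc (8 : ℝ) = 2 ^ 3 := by norm_num
      _ ≤ 2 ^ j := pow_le_pow_right₀ (by norm_num) hj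
  have hs0 : 0 < s := by linarith
  have hP : ((Fintype.card (Cell j) : ℕ) : ℝ) = s ^ 2 := by
    simp [hs, sq]
  have hhs : (h : ℝ) = s ^ 2 / 2 := by
    have : 2 * (h : ℝ) = s ^ 2 := by rw [← hP]; exact_mod_cast hh
    linarith
  have hδ : |3 / s| ≤ 1 / 2 := by
    rw [abs_of_nonneg (by positivity), div_le_div_iff₀ hs0 two_pos]
    linarith
  -- With m ≤ s²/3600 the exponent m · 4 · (3/s)² is at most 1/100, and √(9/400) = 3/20.
  have hηr : ∀ m : ℕ, (m : ℝ) ≤ s ^ 2 / 3600 →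
      2 * √((1 + 4 * (3 / s) ^ 2) ^ m - 1) ≤ 3 / 10 := by
    intro m hm
    have h1 : (1 + 4 * (3 / s) ^ 2) ^ m ≤ Real.exp (1 / 100) := by
      calc (1 + 4 * (3 / s) ^ 2) ^ m ≤ Real.exp (4 * (3 / s) ^ 2) ^ m :=
            pow_le_pow_left₀ (by positivity) (by linarith [Real.add_one_le_exp (4 * (3 / s) ^ 2)]) m
        _ = Real.exp (m * (4 * (3 / s) ^ 2)) := (Real.exp_nat_mul _ _).symm
        _ ≤ _ := Real.exp_le_exp.2 (by
          rw [div_pow, mul_div_assoc', mul_div_assoc', div_le_iff₀ (by positivity)]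
          linarith)
    have h2 : Real.exp (1 / 100) ≤ 409 / 400 := by
      have h3 := Real.one_sub_le_exp_neg (1 / 100)
      rw [Real.exp_neg] at h3
      have h4 := inv_anti₀ (by norm_num) h3
      rw [inv_inv] at h4
      exact h4.trans (by norm_num)
    have h3 : √((1 + 4 * (3 / s) ^ 2) ^ m - 1) ≤ 3 / 20 := by
      rw [Real.sqrt_le_left (by norm_num)]
      linarith
    linarith
  set N : ℝ := ((Fintype.card (Fin t → Bool) : ℕ) : ℝ) * ((Fintype.card (Cell j → Bool) : ℕ) : ℝ) *
    ((Fintype.card (Col j → Col j) : ℕ) : ℝ) * ((Fintype.card (Addr j → ZMod 2) : ℕ) : ℝ) with hN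
  have hN0 : 0 < N := by
    have h1 : 0 < Fintype.card (Fin t → Bool) := Fintype.card_pos
    have h2 : 0 < Fintype.card (Cell j → Bool) := Fintype.card_pos
    have h3 : 0 < Fintype.card (Col j → Col j) := Fintype.card_pos
    have h4 : 0 < Fintype.card (Addr j → ZMod 2) := Fintype.card_pos
    rw [hN]
    exact mul_pos (mul_pos (mul_pos (Nat.cast_pos.2 h1) (Nat.cast_pos.2 h2)) (Nat.cast_pos.2 h3))
      (Nat.cast_pos.2 h4)
  have hupper : ∑ z, ∑ σ, ∑ ρ, ∑ b, ∑ A, (biasProd (-(3 / s)) A - biasProd (3 / s) A) *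
      acceptProb 𝒜 (hardFun e z σ ρ b A) ≤
        N * (1 / 16 + 3 / 10 + d * q / (2 ^ t * (s * (s ^ 2 / 3600)))) := by
    let _ : Fintype ((Addr j → ZMod 2) × (Cell j → Bool)) := instFintypeProd _ _
    let _ : Fintype ((Col j → Col j) × (Addr j → ZMod 2) × (Cell j → Bool)) := instFintypeProd _ _
    let _ : Fintype ((Cell j → Bool) × (Col j → Col j) × (Addr j → ZMod 2) × (Cell j → Bool)) :=
      instFintypeProd _ _
    have := sum_mul_acceptProb_le 𝒜
      (I := (Fin t → Bool) × (Cell j → Bool) × (Col j → Col j) × (Addr j → ZMod 2) ×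
        (Cell j → Bool))
      (fun u => biasProd (-(3 / s)) u.2.2.2.2 - biasProd (3 / s) u.2.2.2.2)
      (fun u => hardFun e u.1 u.2.1 u.2.2.1 u.2.2.2.1 u.2.2.2.2)
      (N * (1 / 16 + 3 / 10 + d * q / (2 ^ t * (s * (s ^ 2 / 3600)))))
    simp only [Fintype.sum_prod_type] at this
    refine this fun D hD => ?_
    refine (sum_hardFun_accept_sub_le hδ e D.query D.verdict d (r₀ := s ^ 2 / 3600) (by positivity)
      (by norm_num) hηr).trans (mul_le_mul_of_nonneg_left ?_ hN0.le)
    have hDq : (D.numQueries : ℝ) ≤ q := by exact_mod_cast hq D hD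
    refine add_le_add (add_le_add ?_ le_rfl) ?_
    · rw [div_le_div_iff₀ (by positivity) (by norm_num), one_mul]
      have : (D.numQueries : ℝ) ^ 2 ≤ (q : ℝ) ^ 2 := pow_le_pow_left₀ (Nat.cast_nonneg _) hDq 2
      linarith
    · gcongr
  have hyes : ∀ z σ ρ b, 5 / 6 * (1 - 1 / 36) ≤
      ∑ A, biasProd (-(3 / s)) A * acceptProb 𝒜 (hardFun e z σ ρ b A) := by
    intro z σ ρ b
    have hδ' : |(-(3 / s))| ≤ 1 / 2 := by rwa [abs_neg]
    -- The mean of |A| is h - 3s, so exceeding h is a deviation of 3s, of probability at most 1/36.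
    have h1 := sum_biasProd_deviation_le (P := Cell j) hδ' (T := 3 * s) (by positivity)
      (fun A => ¬ (Finset.univ.filter fun p => A p).card ≤ h) (fun A hA => by
        rw [not_le] at hA
        have hA' : (h : ℝ) < (Finset.univ.filter fun p => A p).card := by exact_mod_cast hA
        refine le_trans ?_ (le_abs_self _)
        rw [hP]
        have : (1 / 2 + -(3 / s)) * s ^ 2 = s ^ 2 / 2 - 3 * s := by field_simp; ring
        linarith)
    rw [hP] at h1
    have h2 : s ^ 2 / (4 * (3 * s) ^ 2) = 1 / 36 := by field_simp; norm_num
    rw [h2] at h1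
    have h3 : ∑ A : Cell j → Bool, biasProd (-(3 / s)) A * (5 / 6 * (1 -
        if ¬ (Finset.univ.filter fun p => A p).card ≤ h then 1 else 0)) ≤
          ∑ A, biasProd (-(3 / s)) A * acceptProb 𝒜 (hardFun e z σ ρ b A) := by
      refine Finset.sum_le_sum fun A _ => mul_le_mul_of_nonneg_left ?_ (biasProd_nonneg hδ' A)
      split_ifs with hA
      · rw [sub_zero, mul_one]
        refine h𝒜.1 _ (isJunta_hardFun e z σ ρ b A ?_)
        rw [hk]
        exact Nat.add_le_add_left hA _
      · rw [sub_self, mul_zero]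
        exact acceptProb_nonneg _ _
    refine le_trans ?_ h3
    have h4 : ∑ A : Cell j → Bool, biasProd (-(3 / s)) A * (5 / 6 * (1 -
        if ¬ (Finset.univ.filter fun p => A p).card ≤ h then (1 : ℝ) else 0)) =
          5 / 6 * (1 - ∑ A : Cell j → Bool, biasProd (-(3 / s)) A *
            if ¬ (Finset.univ.filter fun p => A p).card ≤ h then 1 else 0) := by
      simp only [mul_left_comm _ (5 / 6 : ℝ), mul_sub, mul_one, Finset.sum_sub_distrib,
        ← Finset.mul_sum, ← Finset.sum_mul, sum_biasProd, one_mul]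
    rw [h4]
    linarith
  have hno : ∀ z σ ρ b,
      ∑ A, biasProd (3 / s) A * acceptProb 𝒜 (hardFun e z σ ρ b A) ≤ 1 / 6 + 1 / 16 := by
    intro z σ ρ b
    -- The mean of |A| is h + 3s, so falling below h + s is a deviation of 2s, of probability at
    -- most 1/16.
    have h1 := sum_biasProd_deviation_le (P := Cell j) hδ (T := 2 * s) (by positivity)
      (fun A => ¬ h + 2 ^ j ≤ (Finset.univ.filter fun p => A p).card) (fun A hA => by
        rw [not_le] at hA
        have hA' : ((Finset.univ.filter fun p => A p).card : ℝ) < h + s := by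
          rw [hs]; exact_mod_cast hA
        refine le_trans ?_ (neg_le_abs _)
        rw [hP]
        have : (1 / 2 + 3 / s) * s ^ 2 = s ^ 2 / 2 + 3 * s := by field_simp
        linarith)
    rw [hP] at h1
    have h2 : s ^ 2 / (4 * (2 * s) ^ 2) = 1 / 16 := by field_simp; norm_num
    rw [h2] at h1
    have h3 : ∑ A, biasProd (3 / s) A * acceptProb 𝒜 (hardFun e z σ ρ b A) ≤
        ∑ A : Cell j → Bool, biasProd (3 / s) A * (1 / 6 +
          if ¬ h + 2 ^ j ≤ (Finset.univ.filter fun p => A p).card then 1 else 0) := by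
      refine Finset.sum_le_sum fun A _ => mul_le_mul_of_nonneg_left ?_ (biasProd_nonneg hδ A)
      have h5 := acceptProb_add_rejectProb 𝒜 (hardFun e z σ ρ b A)
      split_ifs with hA
      · have := h𝒜.2 _ (farFromJuntas_hardFun e z σ ρ b A (k := k) hε (by
          rw [hk, add_assoc]
          exact Nat.add_le_add_left hA _))
        linarith
      · have : 0 ≤ rejectProb 𝒜 (hardFun e z σ ρ b A) := ENNReal.toReal_nonneg
        linarith
    refine h3.trans ?_
    simp only [mul_add, Finset.sum_add_distrib]
    rw [← Finset.sum_mul, sum_biasProd]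
    linarith
  have hlower : N * (5 / 6 * (1 - 1 / 36) - (1 / 6 + 1 / 16)) ≤
      ∑ z, ∑ σ, ∑ ρ, ∑ b, ∑ A, (biasProd (-(3 / s)) A - biasProd (3 / s) A) *
        acceptProb 𝒜 (hardFun e z σ ρ b A) := by
    have h1 : N * (5 / 6 * (1 - 1 / 36) - (1 / 6 + 1 / 16)) =
        ∑ _z : Fin t → Bool, ∑ _σ : Cell j → Bool, ∑ _ρ : Col j → Col j,
          ∑ _b : Addr j → ZMod 2, (5 / 6 * (1 - 1 / 36) - (1 / 6 + 1 / 16) : ℝ) := by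
      simp only [Finset.sum_const, Finset.card_univ, nsmul_eq_mul, hN, mul_assoc]
    rw [h1]
    refine Finset.sum_le_sum fun z _ => Finset.sum_le_sum fun σ _ => Finset.sum_le_sum fun ρ _ =>
      Finset.sum_le_sum fun b _ => ?_
    simp only [sub_mul, Finset.sum_sub_distrib]
    exact sub_le_sub (hyes z σ ρ b) (hno z σ ρ b)
  have hfin := le_of_mul_le_mul_left (hlower.trans hupper) hN0
  -- The tester's average advantage exceeds 1/16 + 3/10 by more than 1/5, which the exposure term
  -- has to supply.
  have h1 : (1 : ℝ) / 5 ≤ d * q / (2 ^ t * (s * (s ^ 2 / 3600))) := by linarith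
  rw [div_le_div_iff₀ (by norm_num) (by positivity)] at h1
  nlinarith

/-- The indicator of the points of odd weight that agree with `z` on the first coordinates. -/
def oddSlice {n t : ℕ} (e : Fin t ↪ Fin n) (z : Fin t → Bool) : Cube n → Bool :=
  fun x => decide ((∀ i, x (e i) = z i) ∧ ∑ i, bit (x i) = 1)

theorem sum_bit_flipAt {n : ℕ} (x : Cube n) (i : Fin n) :
    ∑ l, bit (flipAt x i l) = ∑ l, bit (x l) + 1 :=
  sum_bit_flipAt_of_mem x id Function.injective_id i

/-- Parity is sensitive to every coordinate outside the slice's constraints. A constrained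
coordinate is sensitive wherever the indicator is 1, which is half of the slice because some
coordinate is free (t < n). -/
theorem farFromJuntas_oddSlice {n t k : ℕ} {ε : ℝ} (e : Fin t ↪ Fin n) (htn : t < n) (hk : k < n)
    (hε : ε * 4 * 2 ^ t ≤ 1) (z : Fin t → Bool) : FarFromJuntas k ε (oddSlice e z) := by
  classical
  rintro g ⟨J, hJk, hJ⟩
  obtain ⟨i, hi⟩ : ∃ i, i ∉ J := by
    by_contra! h
    have := Finset.card_le_card (fun i _ => h i : (Finset.univ : Finset (Fin n)) ⊆ J)
    rw [Finset.card_univ, Fintype.card_fin] at this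
    omega
  obtain ⟨l, hl⟩ : ∃ l, ∀ i, e i ≠ l := by
    by_contra! h
    have := Fintype.card_le_of_surjective e h
    rw [Fintype.card_fin, Fintype.card_fin] at this
    omega
  have hflip : ∀ m, (∀ i, e i ≠ m) → ∀ x : Cube n, (∀ i, x (e i) = z i) →
      ∀ i, flipAt x m (e i) = z i := fun m hm x hx i => by rw [flipAt_of_ne _ (hm i), hx]
  have h1 := card_sensitive_le_two_mul_hammingDist (oddSlice e z) g J hJ (fun _ => i)
    (fun _ => by simpa) fun _ => rfl
  have h2 : (Finset.univ.filter fun x : Cube n => ∀ i, x (e i) = z i).card ≤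
      4 * hammingDist (oddSlice e z) g := by
    by_cases hie : ∀ i', e i' ≠ i
    · have : (Finset.univ.filter fun x : Cube n => ∀ i, x (e i) = z i).card ≤
          (Finset.univ.filter fun x => oddSlice e z x ≠ oddSlice e z (flipAt x i)).card := by
        refine Finset.card_le_card fun x hx => ?_
        simp only [Finset.mem_filter, Finset.mem_univ, true_and] at hx ⊢
        simp only [oddSlice, hx, hflip i hie x hx, sum_bit_flipAt, ne_eq, decide_eq_decide,
          implies_true, true_and]
        exact zmod_two_eq_one_iff_of_ne (add_ne_left.2 one_ne_zero).symm
      omega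
    · push Not at hie
      obtain ⟨i', rfl⟩ := hie
      have := card_le_two_mul_card_and_of_toggle (fun x : Cube n => ∀ i, x (e i) = z i)
        (fun x => ∑ i, bit (x i) = 1) l (hflip l hl) (fun x _ h => by
          rw [sum_bit_flipAt]
          revert h
          generalize ∑ i, bit (x i) = u
          revert u; decide)
      have h3 : (Finset.univ.filter fun x : Cube n => (∀ i, x (e i) = z i) ∧
          ∑ i, bit (x i) = 1).card ≤
          (Finset.univ.filter fun x =>
            oddSlice e z x ≠ oddSlice e z (flipAt x (e i'))).card := by
        refine Finset.card_le_card fun x hx => ?_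
        simp only [Finset.mem_filter, Finset.mem_univ, true_and] at hx ⊢
        have h4 : oddSlice e z x = true := decide_eq_true hx
        have h5 : oddSlice e z (flipAt x (e i')) = false := by
          refine decide_eq_false fun h => ?_
          have := h.1 i'
          rw [flipAt_self, hx.1 i'] at this
          cases h' : z i' <;> simp [h'] at this
        rw [h4, h5]
        simp
      omega
  have h3 : (Finset.univ.filter fun x : Cube n => ∀ i, x (e i) = z i).card * 2 ^ t = 2 ^ n := by
    have := card_filter_comp_eq_mul e z
    rw [Fintype.card_fin, Fintype.card_fin] at this
    rw [← this]
    congr 3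
    ext x
    simp only [funext_iff]
    rfl
  have h4 : ((Finset.univ.filter fun x : Cube n => ∀ i, x (e i) = z i).card : ℝ) ≤
      4 * hammingDist (oddSlice e z) g := by exact_mod_cast h2
  have h5 : ((Finset.univ.filter fun x : Cube n => ∀ i, x (e i) = z i).card : ℝ) * 2 ^ t =
      2 ^ n := by exact_mod_cast h3
  have h6 : (0 : ℝ) ≤ (Finset.univ.filter fun x : Cube n => ∀ i, x (e i) = z i).card :=
    Nat.cast_nonneg _
  rw [← h5]
  nlinarith

/-- A tester has to hit a random slice of the cube. -/
theorem pow_le_queries_of_tester {n t k q : ℕ} {ε : ℝ} (htn : t < n) (hk : k < n)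
    (hε : ε * 4 * 2 ^ t ≤ 1) (𝒜 : NonadaptiveAlg n) (h𝒜 : IsJuntaTester k ε 𝒜)
    (hq : QueriesAtMost 𝒜 q) : (2 : ℝ) ^ t * (2 / 3) ≤ q := by
  classical
  let e : Fin t ↪ Fin n := (Fin.castLEEmb htn.le)
  have h0 : IsJunta k (fun _ : Cube n => false) := ⟨∅, by simp, fun _ _ _ => rfl⟩
  have hupper : ∑ z : Fin t → Bool, (acceptProb 𝒜 (fun _ => false) -
      acceptProb 𝒜 (oddSlice e z)) ≤ q := by
    have := sum_mul_acceptProb_le 𝒜 (I := (Fin t → Bool) × Bool) (fun u => if u.2 then 1 else -1)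
      (fun u => if u.2 then fun _ => false else oddSlice e u.1) q
    simp only [Fintype.sum_prod_type, Fintype.sum_bool, if_true, Bool.false_eq_true, if_false,
      one_mul, neg_mul, ← sub_eq_add_neg] at this
    refine this fun D hD => ?_
    -- The verdicts on zero and on the slice can differ only if some query lands in the slice, and
    -- each query lands in just one.
    have hz : ∀ z, ((if D.run fun _ => false then (1 : ℝ) else 0) -
        if D.run (oddSlice e z) then 1 else 0) ≤
          ∑ i : Fin D.numQueries, if (fun l => D.query i (e l)) = z then (1 : ℝ) else 0 := by
      intro z
      by_cases h : ∃ i, (fun l => D.query i (e l)) = z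
      · obtain ⟨i, hi⟩ := h
        have h1 := Finset.single_le_sum (f := fun i : Fin D.numQueries =>
          if (fun l => D.query i (e l)) = z then (1 : ℝ) else 0)
          (fun _ _ => by split_ifs <;> simp) (Finset.mem_univ i)
        simp only [if_pos hi] at h1
        refine le_trans ?_ h1
        split_ifs <;> simp
      · push Not at h
        have h1 : D.run (oddSlice e z) = D.run fun _ => false := by
          unfold DetNonadaptive.run
          congr 1
          ext i
          rw [oddSlice, decide_eq_false]
          exact fun h' => h i (funext h'.1)
        rw [h1, sub_self]
        exact Finset.sum_nonneg fun _ _ => by split_ifs <;> simp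
    refine (Finset.sum_le_sum fun z _ => hz z).trans ?_
    rw [Finset.sum_comm]
    simp only [Finset.sum_ite_eq, Finset.mem_univ, if_true, Finset.sum_const, Finset.card_univ,
      Fintype.card_fin, nsmul_eq_mul, mul_one]
    exact_mod_cast hq D hD
  refine le_trans ?_ hupper
  have h1 : (2 : ℝ) ^ t * (2 / 3) = ∑ _z : Fin t → Bool, (2 / 3 : ℝ) := by simp
  rw [h1]
  refine Finset.sum_le_sum fun z _ => ?_
  have h2 := h𝒜.1 _ h0
  have h3 := h𝒜.2 _ (farFromJuntas_oddSlice e htn hk hε z)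
  have h4 := acceptProb_add_rejectProb 𝒜 (oddSlice e z)
  linarith

end LowerBounds

/-! ### Choice of parameters -/

section Asymptotics

theorem exists_pow_two_near {x : ℝ} (hx : 0 < x) (hx1 : x ≤ 1) :
    ∃ t : ℕ, x * 2 ^ t ≤ 1 ∧ 1 < 2 * x * 2 ^ t := by
  obtain ⟨t, h1, h2⟩ := exists_nat_pow_near ((one_le_inv₀ hx).2 hx1) (one_lt_two (α := ℝ))
  refine ⟨t, ?_, ?_⟩
  · rwa [le_inv_comm₀ (by positivity) hx, ← one_div, le_div_iff₀ (by positivity)] at h1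
  · rw [inv_lt_iff_one_lt_mul₀ hx, pow_succ] at h2
    linarith

theorem one_div_le_queries {n k q : ℕ} {ε : ℝ} (hk : k < n) (hε0 : (2 : ℝ) ^ (-(n : ℝ)) ≤ ε)
    (hε1 : ε ≤ 1 / 6) (𝒜 : NonadaptiveAlg n) (h𝒜 : IsJuntaTester k ε 𝒜)
    (hq : QueriesAtMost 𝒜 q) : 1 / (12 * ε) ≤ q := by
  have hεn : 1 ≤ ε * 2 ^ n := by
    rw [Real.rpow_neg two_pos.le, Real.rpow_natCast, inv_le_iff_one_le_mul₀ (by positivity)] at hε0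
    exact hε0
  have hε : 0 < ε := lt_of_lt_of_le (Real.rpow_pos_of_pos two_pos _) hε0
  obtain ⟨t, h1, h2⟩ := exists_pow_two_near (x := ε * 4) (by positivity) (by linarith)
  have htn : t < n := by
    by_contra! h
    have h3 : (2 : ℝ) ^ n ≤ 2 ^ t := pow_le_pow_right₀ one_le_two h
    have h4 : ε * 2 ^ n ≤ ε * 2 ^ t := mul_le_mul_of_nonneg_left h3 hε.le
    linarith
  refine le_trans ?_ (pow_le_queries_of_tester htn hk h1 𝒜 h𝒜 hq)
  rw [div_le_iff₀ (by positivity)]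
  linarith

/-- The main lower bound, when the proximity parameter is not too small compared to `k`. -/
theorem rpow_div_le_mul_queries {n k q d t : ℕ} {ε β : ℝ} (hβ0 : 0 < β) (hβ1 : β ≤ 1 / 4)
    (hβk : 64 ≤ β * k) (hn : (1 + 2 * β) * k ≤ n) (ht : 4 * t ≤ k) (hε : 0 < ε)
    (h1 : ε * 6 * 2 ^ t ≤ 1) (h2 : 1 < 2 * (ε * 6) * 2 ^ t)
    (𝒜 : NonadaptiveAlg n) (h𝒜 : IsJuntaTester k ε 𝒜) (hq : QueriesAtMost 𝒜 q)
    (hd : 16 * (q : ℝ) ^ 2 ≤ 2 ^ d) :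
    β ^ 2 * ((k : ℝ) ^ (3 / 2 : ℝ) / ε) ≤ 1728000 * d * q := by
  -- The number 4 ^ j of cells is taken within a factor 4 of βk, so that the k + 4 ^ j / 2
  -- coordinates fit into n.
  obtain ⟨j, hj1, hj2⟩ := exists_nat_pow_near (x := β * k) (y := 4) (by linarith) (by norm_num)
  have hk0 : (256 : ℝ) ≤ k := by nlinarith [Nat.cast_nonneg (α := ℝ) k]
  have hj : 3 ≤ j := by
    by_contra! h
    have h3 : (4 : ℝ) ^ (j + 1) ≤ 4 ^ 3 := pow_le_pow_right₀ (by norm_num) (by omega)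
    linarith
  have h4 : 4 * 4 ^ j ≤ k := by
    have : (4 : ℝ) * 4 ^ j ≤ k := by nlinarith
    exact_mod_cast this
  have hcell : Fintype.card (Cell j) = 4 ^ j := by
    simp only [Fintype.card_prod, Fintype.card_fun, Fintype.card_bool, Fintype.card_fin]
    rw [← mul_pow]
    norm_num
  have haux : ∀ r, Fintype.card (Aux j t r) = 2 ^ j * j + (t + (r + 1 + 1)) := fun r => by
    simp only [Fintype.card_sum, Fintype.card_prod, Fintype.card_fun, Fintype.card_bool,
      Fintype.card_fin, Fintype.card_unit]
  obtain ⟨h, hh⟩ : ∃ h, 4 ^ j = 2 * h := by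
    obtain ⟨i, rfl⟩ : ∃ i, j = i + 1 := ⟨j - 1, by omega⟩
    exact ⟨2 * 4 ^ i, by ring⟩
  have h5 : 2 ^ j * j ≤ 4 ^ j := by
    calc 2 ^ j * j ≤ 2 ^ j * 2 ^ j := Nat.mul_le_mul_left _ Nat.lt_two_pow_self.le
      _ = 4 ^ j := by rw [← mul_pow]; norm_num
  have hk0' : 256 ≤ k := by exact_mod_cast hk0
  -- Parity bits absorb the slack: cells, selectors and h take at most 5/8 of k, and the slots at
  -- most 1/4.
  obtain ⟨r, hr⟩ : ∃ r, k = 4 ^ j + (2 ^ j * j + (t + (r + 1 + 1))) + h :=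
    ⟨k - (4 ^ j + (2 ^ j * j + (t + (1 + 1))) + h), by omega⟩
  have hkh : k + h ≤ n := by
    have h6 : (2 : ℝ) * h = 4 ^ j := by exact_mod_cast hh.symm
    have h7 : (k : ℝ) + h ≤ n := by linarith
    exact_mod_cast h7
  have hcard : Fintype.card (Coord j t r) ≤ Fintype.card (Fin n) := by
    have : Fintype.card (Coord j t r) = 4 ^ j * 2 + Fintype.card (Aux j t r) := by
      rw [Fintype.card_sum, Fintype.card_prod, hcell, Fintype.card_bool]
    rw [this, haux, Fintype.card_fin]
    omega
  obtain ⟨e⟩ := Function.Embedding.nonempty_of_card_le hcard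
  have hmain := pow_le_mul_queries_of_tester (h := h) hj e (by rw [hcell, hh])
    (by rw [hcell, haux]; exact hr) h1 𝒜 h𝒜 hq hd
  have hs : (β * k / 4) ^ (3 / 2 : ℝ) ≤ (2 ^ j) ^ 3 := by
    have h6 : β * k / 4 ≤ ((2 : ℝ) ^ j) ^ (2 : ℝ) := by
      rw [Real.rpow_two, ← pow_mul, mul_comm j, pow_mul]
      norm_num
      rw [pow_succ] at hj2
      linarith
    refine (Real.rpow_le_rpow (by positivity) h6 (by norm_num)).trans (le_of_eq ?_)
    rw [← Real.rpow_mul (by positivity), ← Real.rpow_natCast]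
    norm_num
  have hβ : β ^ 2 / 8 * (k : ℝ) ^ (3 / 2 : ℝ) ≤ (β * k / 4) ^ (3 / 2 : ℝ) := by
    rw [Real.div_rpow (by positivity) (by norm_num), Real.mul_rpow hβ0.le (by positivity)]
    have h6 : (4 : ℝ) ^ (3 / 2 : ℝ) = 8 := by
      rw [show (4 : ℝ) = 2 ^ (2 : ℝ) by norm_num, ← Real.rpow_mul (by norm_num)]
      norm_num
    have h7 : β ^ 2 ≤ β ^ (3 / 2 : ℝ) := by
      rw [← Real.rpow_two]
      exact Real.rpow_le_rpow_of_exponent_ge hβ0 (by linarith) (by norm_num)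
    rw [h6, div_mul_eq_mul_div]
    have h8 : 0 ≤ (k : ℝ) ^ (3 / 2 : ℝ) := by positivity
    gcongr
  have h6 : β ^ 2 / 8 * (k : ℝ) ^ (3 / 2 : ℝ) ≤ (2 ^ j) ^ 3 := hβ.trans hs
  rw [mul_div_assoc', div_le_iff₀ hε]
  have h7 : 2 ^ t * (β ^ 2 / 8 * (k : ℝ) ^ (3 / 2 : ℝ)) ≤ 18000 * d * q :=
    (mul_le_mul_of_nonneg_left h6 (by positivity)).trans hmain
  have h8 : 0 ≤ β ^ 2 / 8 * (k : ℝ) ^ (3 / 2 : ℝ) := by positivity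
  have h9 : β ^ 2 / 8 * (k : ℝ) ^ (3 / 2 : ℝ) ≤
      12 * ε * (2 ^ t * (β ^ 2 / 8 * (k : ℝ) ^ (3 / 2 : ℝ))) := by nlinarith
  nlinarith

theorem mul_overPolylog_le_queries {n k q : ℕ} {ε β : ℝ} (hβ0 : 0 < β) (hβ1 : β ≤ 1 / 4)
    (hn : (1 + 2 * β) * k ≤ n) (hε0 : (2 : ℝ) ^ (-(n : ℝ)) ≤ ε) (hε1 : ε ≤ 1 / 6)
    (𝒜 : NonadaptiveAlg n) (h𝒜 : IsJuntaTester k ε 𝒜) (hq : QueriesAtMost 𝒜 q) :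
    β ^ 2 / 20000000 * overPolylog 2 ((k : ℝ) ^ (3 / 2 : ℝ) / ε) ≤ q := by
  have hε : 0 < ε := lt_of_lt_of_le (Real.rpow_pos_of_pos two_pos _) hε0
  rcases Nat.eq_zero_or_pos k with rfl | hk
  · have : ((0 : ℕ) : ℝ) ^ (3 / 2 : ℝ) = 0 := by
      rw [Nat.cast_zero, Real.zero_rpow (by norm_num)]
    rw [this, zero_div, overPolylog, zero_div, mul_zero]
    exact Nat.cast_nonneg _
  have hk1 : (1 : ℝ) ≤ k := by exact_mod_cast hk
  have hkn : k < n := by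
    have : (k : ℝ) < n := by nlinarith
    exact_mod_cast this
  set F : ℝ := (k : ℝ) ^ (3 / 2 : ℝ) / ε with hF
  have hk32 : (1 : ℝ) ≤ (k : ℝ) ^ (3 / 2 : ℝ) := Real.one_le_rpow hk1 (by norm_num)
  have hFε : 1 / ε ≤ F := div_le_div_of_nonneg_right hk32 hε.le
  have hF6 : 6 ≤ F := le_trans (by rw [le_div_iff₀ hε]; linarith) hFε
  set L : ℝ := Real.log (2 + F) with hL
  have hL1 : 1 ≤ L := by
    rw [hL, Real.le_log_iff_exp_le (by linarith)]
    linarith [Real.exp_one_lt_d9]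
  have hexpL : Real.exp L = 2 + F := Real.exp_log (by linarith)
  have htriv := one_div_le_queries hkn hε0 hε1 𝒜 h𝒜 hq
  have hop : overPolylog 2 F = F / L ^ 2 := rfl
  rw [hop, mul_div_assoc', div_le_iff₀ (by positivity)]
  obtain ⟨t, h1, h2⟩ := exists_pow_two_near (x := ε * 6) (by positivity) (by linarith)
  -- If this fails, βk ≤ 64 L. Then k^(3/2) ≤ k² costs only L², so the bound of order 1/ε suffices;
  -- this is why the exponent of the logarithm is 2.
  by_cases hcase : 64 ≤ β * k ∧ 4 * t ≤ k
  · by_contra! hlt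
    have hqF : (q : ℝ) ≤ F := by
      have hβ2 : β ^ 2 / 20000000 ≤ 1 := by nlinarith
      calc (q : ℝ) ≤ q * L ^ 2 :=
            le_mul_of_one_le_right (Nat.cast_nonneg _) (one_le_pow₀ hL1)
        _ ≤ β ^ 2 / 20000000 * F := hlt.le
        _ ≤ F := mul_le_of_le_one_left (by linarith) hβ2
    obtain ⟨d, hd1, hd2⟩ : ∃ d : ℕ, 16 * (q : ℝ) ^ 2 ≤ 2 ^ d ∧ (d : ℝ) ≤ 9 * L := by
      -- The 4 supplies the factor 16. Since log 2 > 1/2, 2 ^ (4L) ≥ exp(2L) = (2 + F)² ≥ q², and L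
      -- ≥ 1 gives d ≤ 9L.
      refine ⟨⌈4 * L⌉₊ + 4, ?_, ?_⟩
      · have h3 : (q : ℝ) ^ 2 ≤ Real.exp (2 * L) := by
          rw [two_mul, Real.exp_add, hexpL, ← sq]
          exact pow_le_pow_left₀ (Nat.cast_nonneg _) (by linarith) 2
        have h4 : Real.exp (2 * L) ≤ 2 ^ ⌈4 * L⌉₊ := by
          have h5 : (2 : ℝ) ^ ⌈4 * L⌉₊ = Real.exp (⌈4 * L⌉₊ * Real.log 2) := by
            rw [Real.exp_nat_mul, Real.exp_log two_pos]
          rw [h5, Real.exp_le_exp]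
          have h6 := Nat.le_ceil (4 * L)
          have h7 := Real.log_two_gt_d9
          nlinarith
        rw [pow_add]
        linarith
      · push_cast
        have := Nat.ceil_lt_add_one (a := 4 * L) (by linarith)
        linarith
    have h3 := rpow_div_le_mul_queries hβ0 hβ1 hcase.1 hn hcase.2 hε h1 h2 𝒜 h𝒜 hq hd1
    rw [← hF] at h3
    have hq0 : (0 : ℝ) ≤ q := Nat.cast_nonneg _
    have h4 : β ^ 2 * F ≤ 1728000 * (9 * L) * q :=
      h3.trans (mul_le_mul_of_nonneg_right (by linarith) hq0)
    have h5 : L * q ≤ q * L ^ 2 := by nlinarith [mul_nonneg hq0 (by linarith : (0 : ℝ) ≤ L)]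
    have h6 : 0 < β ^ 2 * F := by positivity
    nlinarith
  · have hkL : β * k ≤ 64 * L := by
      rw [not_and_or, not_le, not_le] at hcase
      rcases hcase with h | h
      · nlinarith
      · have h3 : (2 : ℝ) ^ t ≤ 2 + F := by
          have : (2 : ℝ) ^ t ≤ 1 / ε := by rw [le_div_iff₀ hε]; nlinarith [pow_pos (two_pos (α := ℝ)) t]
          linarith
        have h4 : t * Real.log 2 ≤ L := by
          rw [← Real.log_pow]
          exact Real.log_le_log (by positivity) h3
        have h5 := Real.log_two_gt_d9
        have h6 : (k : ℝ) < 4 * t := by exact_mod_cast h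
        have h7 : (0 : ℝ) ≤ t := Nat.cast_nonneg _
        nlinarith
    have h3 : (k : ℝ) ^ (3 / 2 : ℝ) ≤ (k : ℝ) ^ 2 := by
      rw [← Real.rpow_two]
      exact Real.rpow_le_rpow_of_exponent_le hk1 (by norm_num)
    have h4 : β ^ 2 * (k : ℝ) ^ (3 / 2 : ℝ) ≤ 4096 * L ^ 2 := by
      have h5 : (β * k) ^ 2 ≤ (64 * L) ^ 2 := pow_le_pow_left₀ (by positivity) hkL 2
      have h6 := mul_le_mul_of_nonneg_left h3 (sq_nonneg β)
      rw [mul_pow, mul_pow] at h5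
      linarith
    have h5 : β ^ 2 * F ≤ 4096 * L ^ 2 * (1 / ε) := by
      rw [hF, mul_div_assoc', mul_one_div]
      exact div_le_div_of_nonneg_right h4 hε.le
    have h6 : 1 / ε ≤ 12 * q := by
      have : 1 / (12 * ε) = 1 / ε / 12 := by field_simp
      linarith
    have h7 : 4096 * L ^ 2 * (1 / ε) ≤ 4096 * L ^ 2 * (12 * q) :=
      mul_le_mul_of_nonneg_left h6 (by positivity)
    have h8 : (0 : ℝ) ≤ q * L ^ 2 := by positivity
    linarith

end Asymptotics

theorem theorem1 (α : ℝ) (hα₀ : 1 / 2 < α) (hα₁ : α < 1) :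
    ∃ (c : ℝ) (C : ℕ), 0 < c ∧
      ∀ (k : ℕ → ℕ) (ε : ℕ → ℝ),
        (∀ᶠ n : ℕ in Filter.atTop,
          (k n : ℝ) ≤ α * n ∧ (2 : ℝ) ^ (-(n : ℝ)) ≤ ε n ∧ ε n ≤ 1 / 6) →
        ∀ᶠ n : ℕ in Filter.atTop,
          ∀ (A : NonadaptiveAlg n) (q : ℕ),
            IsJuntaTester (k n) (ε n) A → QueriesAtMost A q →
              c * overPolylog C ((k n : ℝ) ^ (3 / 2 : ℝ) / ε n) ≤ (q : ℝ) := by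
  -- With β = (1 - α)/2, (1 + 2β)k ≤ (2 - α)αn ≤ n, as (2 - α)α = 1 - (1 - α)²; and α > 1/2 gives β
  -- ≤ 1/4.
  have hβ : 0 < (1 - α) / 2 := by linarith
  refine ⟨((1 - α) / 2) ^ 2 / 20000000, 2, by positivity, fun k ε h => ?_⟩
  filter_upwards [h] with n hn A q hA hq
  refine mul_overPolylog_le_queries hβ (by linarith) ?_ hn.2.1 hn.2.2 A hA hq
  have h1 : (1 + 2 * ((1 - α) / 2)) * (k n : ℝ) ≤ (1 + (1 - α)) * (α * n) := by
    rw [mul_div_cancel₀ _ (two_ne_zero' ℝ)]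
    exact mul_le_mul_of_nonneg_left hn.1 (by linarith)
  have h2 : (1 + (1 - α)) * α ≤ 1 := by nlinarith [sq_nonneg (1 - α)]
  have h3 : (0 : ℝ) ≤ n := Nat.cast_nonneg _
  nlinarith
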